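/- Let $T=(\mathbb{C}^*)^n\subset GL_n(\mathbb{C})$ be the diagonal torus, with coordinate characters $t_1,\dots,t_n$, and let $\mathbb{C}^*_q$ be a copy of $\mathbb{C}^*$ with coordinate character $q$. Let $Quot_{\mathbb{P}^1,d}(\mathbb{C}^n,r)$ be the Quot scheme of quotients $\mathbb{C}^n\otimes\mathcal{O}_{\mathbb{P}^1}\to\mathcal{Q}$ with Hilbert polynomial $(n-r)(m+1)+d$; a point is given by the kernel $\mathcal{K}\subset\mathbb{C}^n\otimes\mathcal{O}_{\mathbb{P}^1}$, locally free of rank $r$ and degree $-d$. The group $T$ acts on kernels through its action on $\mathbb{C}^n$, and $\mathbb{C}^*_q$ acts by pulling back kernels along $[x:y]\mapsto[qx:y]$. Let $\delta\subseteq\{1,\dots,n\}$ and $a_i,b_i\in\mathbb{Z}_{\ge 0}$ for $i\in\delta$, and let $p$ be the $T\times\mathbb{C}^*_q$-fixed point of $Quot_{\mathbb{P}^1,d}(\mathbb{C}^n,r)$ whose kernel is the image of $$\bigoplus_{i\in\delta}\mathbb{C}_{t_i}\otimes\mathcal{O}_{\mathbb{P}^1}(-a_i-b_i)\longrightarrow\mathbb{C}^n\otimes\mathcal{O}_{\mathbb{P}^1}=\bigoplus_{i=1}^n\mathbb{C}_{t_i}\otimes\mathcal{O}_{\mathbb{P}^1},$$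 the $i$-th summand being mapped to $\mathbb{C}_{t_i}\otimes\mathcal{O}_{\mathbb{P}^1}$ by multiplication by $x^{a_i}y^{b_i}$ (so $|\delta|=r$ and $\sum_{i\in\delta}(a_i+b_i)=d$). (1) The $T\times\mathbb{C}^*_q$-module $T_pQuot_{\mathbb{P}^1,d}(\mathbb{C}^n,r)$ is a direct sum of one-dimensional weight spaces with the following weights, counted with multiplicity: - $\frac{t_j}{t_i}q^{-a_i+s}$ for $i\in\delta$, $j\notin\delta$, $0\le s\le a_i+b_i$; - $q^{-a_i+s}$ for $i\in\delta$, $0\le s\le a_i+b_i$, $s\ne a_i$; - $\frac{t_j}{t_i}q^{s}$ for $i\ne j$ in $\delta$, $-a_i\le s\le -a_i+a_j-1$; - $\frac{t_j}{t_i}q^{s}$ for $i\ne j$ in $\delta$, $b_i-b_j+1\le s\le b_i$. (2) For a finite-dimensional $T\times\mathbb{C}^*_q$-module $V$ let $\lambda_y(V)=\sum_{k\ge0}y^k[\wedge^kV]\in K_{T\times\mathbb{C}^*_q}(\mathrm{pt})[y]=\mathbb{Z}[t_1^{\pm1},\dots,t_n^{\pm1},q^{\pm1}][y]$. If $p$ is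 supported at $0=\{x=0\}$, that is, $b_i=0$ for all $i\in\delta$, write $d_i=a_i$. Then $\lambda_y(T_p^*Quot_{\mathbb{P}^1,d}(\mathbb{C}^n,r))=ABC$, where $$A=\prod_{i\in\delta}\prod_{j\notin\delta}\prod_{m=0}^{d_i}\Bigl(1+y\tfrac{t_i}{t_j}q^m\Bigr),\qquad B=\prod_{i\in\delta}\prod_{m=1}^{d_i}(1+yq^m),\qquad C=\prod_{\substack{i,j\in\delta\\ i\ne j}}\ \prod_{m=-d_i}^{-d_i+d_j-1}\Bigl(1+y\tfrac{t_i}{t_j}q^{-m}\Bigr).$$ -/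

import Mathlib

open Polynomial LaurentPolynomial

noncomputable section

namespace QuotP1

/-! ### Submodules of free modules and change of rings -/

section Push

variable {n : ℕ} {A B C : Type*} [CommRing A] [CommRing B] [CommRing C]

/-- For a ring homomorphism `φ : A → B` and a vector `c` in `B ^ n`, the `B`-submodule of `B ^ n`
generated by all vectors `(c_j * φ (f_j))_j` with `f` in the submodule `K` of `A ^ n`.
With `c = 1` this is the image of `B ⊗ K` in `B ^ n`. -/
def push (φ : A →+* B) (c : Fin n → B) (K : Submodule A (Fin n → A)) :
    Submodule B (Fin n → B) :=
  Submodule.span B ((fun f j => c j * φ (f j)) '' (K : Set (Fin n → A)))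

lemma mem_push_of_mem (φ : A →+* B) (c : Fin n → B) {K : Submodule A (Fin n → A)}
    {f : Fin n → A} (hf : f ∈ K) : (fun j => c j * φ (f j)) ∈ push φ c K :=
  Submodule.subset_span ⟨f, hf, rfl⟩

lemma push_push (φ : A →+* B) (c : Fin n → B) (ψ : B →+* C) (d : Fin n → C)
    (K : Submodule A (Fin n → A)) :
    push ψ d (push φ c K) = push (ψ.comp φ) (fun j => d j * ψ (c j)) K := by
  apply le_antisymm
  · refine Submodule.span_le.2 ?_
    rintro _ ⟨g, hg, rfl⟩
    simp only [SetLike.mem_coe] at hg ⊢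
    refine Submodule.span_induction
      (p := fun g _ => (fun j => d j * ψ (g j)) ∈ push (ψ.comp φ) (fun j => d j * ψ (c j)) K)
      ?_ ?_ ?_ ?_ hg
    · rintro _ ⟨f, hf, rfl⟩
      convert mem_push_of_mem (ψ.comp φ) (fun j => d j * ψ (c j)) hf using 2
      simp [mul_assoc]
    · convert Submodule.zero_mem (push (ψ.comp φ) (fun j => d j * ψ (c j)) K) using 1
      ext j; simp
    · intro x y _ _ hx hy
      convert Submodule.add_mem _ hx hy using 1
      ext j; simp [mul_add]
    · intro b x _ hx
      convert Submodule.smul_mem _ (ψ b) hx using 1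
      ext j; simp; ring
  · refine Submodule.span_le.2 ?_
    rintro _ ⟨f, hf, rfl⟩
    convert mem_push_of_mem ψ d (mem_push_of_mem φ c hf) using 2
    simp [mul_assoc]

lemma mem_push_of_surjective (φ : A →+* B) (hφ : Function.Surjective φ) (c : Fin n → B)
    (K : Submodule A (Fin n → A)) (g : Fin n → B) :
    g ∈ push φ c K ↔ ∃ f ∈ K, g = fun j => c j * φ (f j) := by
  constructor
  · intro hg
    refine Submodule.span_induction (p := fun g _ => ∃ f ∈ K, g = fun j => c j * φ (f j))
      ?_ ?_ ?_ ?_ hg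
    · rintro _ ⟨f, hf, rfl⟩
      exact ⟨f, hf, rfl⟩
    · exact ⟨0, K.zero_mem, by ext; simp⟩
    · rintro _ _ _ _ ⟨f, hf, rfl⟩ ⟨f', hf', rfl⟩
      exact ⟨f + f', K.add_mem hf hf', by ext; simp [mul_add]⟩
    · rintro b _ _ ⟨f, hf, rfl⟩
      obtain ⟨a, rfl⟩ := hφ b
      exact ⟨a • f, K.smul_mem a hf, by ext; simp; ring⟩
  · rintro ⟨f, hf, rfl⟩
    exact mem_push_of_mem φ c hf

lemma push_id (K : Submodule A (Fin n → A)) : push (RingHom.id A) 1 K = K := by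
  ext g
  rw [mem_push_of_surjective _ Function.surjective_id]
  simp

/-- If `B` is the localization of `A` at the powers of `u`, then `push φ 1 K` is the
localization of `K`. -/
lemma mem_push_of_localization (φ : A →+* B) (u : A) (v : B) (huv : φ u * v = 1)
    (hloc : ∀ b : B, ∃ (m : ℕ) (a : A), φ a = φ u ^ m * b)
    (K : Submodule A (Fin n → A)) (g : Fin n → B) :
    g ∈ push φ 1 K ↔ ∃ (m : ℕ), ∃ f ∈ K, ∀ j, φ (f j) = φ u ^ m * g j := by
  constructor
  · intro hg
    refine Submodule.span_induction
      (p := fun g _ => ∃ (m : ℕ), ∃ f ∈ K, ∀ j, φ (f j) = φ u ^ m * g j) ?_ ?_ ?_ ?_ hg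
    · rintro _ ⟨f, hf, rfl⟩
      exact ⟨0, f, hf, by simp⟩
    · exact ⟨0, 0, K.zero_mem, by simp⟩
    · rintro _ _ _ _ ⟨m, f, hf, h⟩ ⟨m', f', hf', h'⟩
      refine ⟨m + m', u ^ m' • f + u ^ m • f',
        K.add_mem (K.smul_mem _ hf) (K.smul_mem _ hf'), fun j => ?_⟩
      simp [h, h']; ring
    · rintro b _ _ ⟨m, f, hf, h⟩
      obtain ⟨m', a, ha⟩ := hloc b
      refine ⟨m + m', a • f, K.smul_mem _ hf, fun j => ?_⟩
      simp [h, ha]; ring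
  · rintro ⟨m, f, hf, h⟩
    have h1 : v ^ m * φ u ^ m = 1 := by rw [← mul_pow, mul_comm, huv, one_pow]
    have h3 := mem_push_of_mem φ 1 hf
    have h2 := Submodule.smul_mem _ (v ^ m) h3
    have h4 : (v ^ m • fun j => (1 : Fin n → B) j * φ (f j)) = g := by
      funext j
      rw [Pi.smul_apply, Pi.one_apply, one_mul, smul_eq_mul, h, ← mul_assoc, h1, one_mul]
    rw [h4] at h2
    exact h2

end Push

/-! ### Quasi-coherent subsheaves of `𝒪 ^ n` on the projective line -/

section Subsheaf

variable {R S : Type*} [CommRing R] [CommRing S]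

/-- Restriction of functions from the chart `y ≠ 0` (coordinate `X = x / y`) of the projective line
`ℙ¹` over `R` to the overlap, whose coordinate is `T = x / y`. -/
def res0 : R[X] →+* R[T;T⁻¹] := toLaurent

/-- Restriction of functions from the chart `x ≠ 0` (coordinate `X = y / x`) of `ℙ¹` over `R` to
the overlap, whose coordinate is `T = x / y`. -/
def res1 : R[X] →+* R[T;T⁻¹] := (invert (R := R) : R[T;T⁻¹] →+* R[T;T⁻¹]).comp toLaurent

variable (R) in
/-- A quasi-coherent subsheaf of `𝒪 ^ n` on `ℙ¹` over `R`, with homogeneous coordinates `[x : y]`: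
a submodule on each of the two standard charts, `y ≠ 0` with coordinate `x / y` and `x ≠ 0` with
coordinate `y / x`, such that both have the same restriction to the overlap. -/
structure Subsheaf (n : ℕ) where
  /-- Sections over the chart `y ≠ 0`. -/
  K0 : Submodule R[X] (Fin n → R[X])
  /-- Sections over the chart `x ≠ 0`. -/
  K1 : Submodule R[X] (Fin n → R[X])
  glue : push res0 1 K0 = push res1 1 K1

variable {n : ℕ}

/-- Sections of a subsheaf over the overlap of the two charts. -/
def Subsheaf.K01 (K : Subsheaf R n) : Submodule R[T;T⁻¹] (Fin n → R[T;T⁻¹]) := push res0 1 K.K0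

lemma res0_C (a : R) : res0 (Polynomial.C a) = LaurentPolynomial.C a := by simp [res0]
lemma res1_C (a : R) : res1 (Polynomial.C a) = LaurentPolynomial.C a := by simp [res1]
lemma res0_X : res0 (X : R[X]) = T 1 := by simp [res0]
lemma res1_X : res1 (X : R[X]) = T (-1) := by simp [res1]
lemma mapL_C (f : R →+* S) (a : R) :
    AddMonoidAlgebra.mapRingHom ℤ f (LaurentPolynomial.C a) = LaurentPolynomial.C (f a) :=
  AddMonoidAlgebra.mapRingHom_single f 0 a
lemma mapL_T (f : R →+* S) (m : ℤ) :
    AddMonoidAlgebra.mapRingHom ℤ f (T m) = T m := by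
  have := AddMonoidAlgebra.mapRingHom_single f m 1
  rw [map_one] at this
  exact this

lemma map_res0 (f : R →+* S) :
    (res0 (R := S)).comp (mapRingHom f) = (AddMonoidAlgebra.mapRingHom ℤ f).comp res0 := by
  apply Polynomial.ringHom_ext
  · intro a
    simp only [RingHom.comp_apply, coe_mapRingHom, Polynomial.map_C, res0_C, mapL_C]
  · simp only [RingHom.comp_apply, coe_mapRingHom, Polynomial.map_X, res0_X, mapL_T]

lemma map_res1 (f : R →+* S) :
    (res1 (R := S)).comp (mapRingHom f) = (AddMonoidAlgebra.mapRingHom ℤ f).comp res1 := by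
  apply Polynomial.ringHom_ext
  · intro a
    simp only [RingHom.comp_apply, coe_mapRingHom, Polynomial.map_C, res1_C, mapL_C]
  · simp only [RingHom.comp_apply, coe_mapRingHom, Polynomial.map_X, res1_X, mapL_T]

/-- Pull-back of a subsheaf along a ring homomorphism `f : R → S` (its image in `𝒪 ^ n`, so that
the quotient of `𝒪 ^ n` by the result is the base change of the quotient sheaf). -/
def Subsheaf.baseChange (K : Subsheaf R n) (f : R →+* S) : Subsheaf S n where
  K0 := push (mapRingHom f) 1 K.K0
  K1 := push (mapRingHom f) 1 K.K1
  glue := by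
    have h := congrArg (push (AddMonoidAlgebra.mapRingHom ℤ f) 1) K.glue
    rw [push_push, push_push, ← map_res0, ← map_res1] at h
    rw [push_push, push_push]
    simpa using h

/-! ### The Quot scheme of `ℙ¹`, through its functor of points -/

/-- For a field `k`, the sections over `ℙ¹` of the twist `Q(m)` of the quotient `Q = 𝒪 ^ n / K`:
pairs of local sections `s0`, `s1` of `Q` on the two charts with `s0 = T ^ m * s1` on the
overlap. -/
def globalSections {k : Type*} [Field k] (K : Subsheaf k n) (m : ℤ) :
    Submodule k (((Fin n → k[X]) ⧸ K.K0) × ((Fin n → k[X]) ⧸ K.K1)) :=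
  Submodule.map
    (LinearMap.prodMap (K.K0.mkQ.restrictScalars k) (K.K1.mkQ.restrictScalars k))
    { carrier := {s | (fun j => res0 (s.1 j) - T m * res1 (s.2 j)) ∈ K.K01}
      add_mem' := by
        intro a b ha hb
        rw [Set.mem_ofPred_eq] at ha hb ⊢
        convert K.K01.add_mem ha hb using 1
        ext1 j
        simp only [Prod.fst_add, Prod.snd_add, Pi.add_apply, map_add]
        ring
      zero_mem' := by
        rw [Set.mem_ofPred_eq]
        convert K.K01.zero_mem using 1
        ext1 j
        simp
      smul_mem' := by
        intro c a ha
        rw [Set.mem_ofPred_eq] at ha ⊢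
        convert K.K01.smul_mem (LaurentPolynomial.C c) ha using 1
        ext1 j
        simp only [Prod.smul_fst, Prod.smul_snd, Pi.smul_apply, Polynomial.smul_eq_C_mul, map_mul,
          res0_C, res1_C, smul_eq_mul]
        ring }

universe u

/-- `K` is the kernel of an `R`-valued point of the Quot scheme `Quot_{ℙ¹,d}(ℂⁿ, r)`: the quotient
`Q = 𝒪 ^ n / K` is a finitely presented sheaf, flat over `R`, whose restriction to the fibre over
every field-valued point of `Spec R` has Hilbert polynomial `(n - r) (m + 1) + d`. -/
structure IsQuot {R : Type u} [CommRing R] {n : ℕ} (r d : ℕ) (K : Subsheaf R n) : Prop where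
  fg0 : K.K0.FG
  fg1 : K.K1.FG
  flat0 : Module.Flat R ((Fin n → R[X]) ⧸ K.K0)
  flat1 : Module.Flat R ((Fin n → R[X]) ⧸ K.K1)
  hilbert : ∀ (k : Type u) [Field k] (f : R →+* k), ∃ m₀ : ℕ, ∀ m : ℕ, m₀ ≤ m →
    Module.Finite k (globalSections (K.baseChange f) m) ∧
    (Module.finrank k (globalSections (K.baseChange f) m) : ℤ) = (n - r) * (m + 1) + d

/-- The `R`-valued points of the Quot scheme `Quot_{ℙ¹,d}(ℂⁿ, r)`. -/
def QuotPoint (R : Type u) [CommRing R] (n r d : ℕ) : Type u := {K : Subsheaf R n // IsQuot r d K}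

end Subsheaf

/-! ### The torus action -/

section Torus

variable {R S : Type*} [CommRing R] [CommRing S] {n : ℕ}

/-- The torus `T × ℂ*_q`, where `T` is the torus of diagonal matrices in `GL_n(ℂ)`. -/
abbrev Torus (n : ℕ) : Type := (Fin n → ℂˣ) × ℂˣ

/-- The substitution `X ↦ c * X`. -/
def scale (c : R) : R[X] →+* R[X] := eval₂RingHom Polynomial.C (Polynomial.C c * X)

/-- The substitution `T ↦ c * T`. -/
def scaleL (c : Rˣ) : R[T;T⁻¹] →+* R[T;T⁻¹] :=
  LaurentPolynomial.eval₂ LaurentPolynomial.C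
    (Units.map (LaurentPolynomial.C (R := R)).toMonoidHom c *
      ⟨T 1, T (-1), by rw [← T_add]; simp, by rw [← T_add]; simp⟩)

lemma scale_C (c a : R) : scale c (Polynomial.C a) = Polynomial.C a := by simp [scale]
lemma scale_X (c : R) : scale c X = Polynomial.C c * X := by simp [scale]

lemma res0_scale (c : Rˣ) : (res0 (R := R)).comp (scale (c : R)) = (scaleL c).comp res0 := by
  apply Polynomial.ringHom_ext
  · intro a
    simp [scale_C, res0_C, scaleL]
  · simp [scale_X, res0_X, res0_C, scaleL]

lemma res1_scale (c : Rˣ) :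
    (res1 (R := R)).comp (scale ((c⁻¹ : Rˣ) : R)) = (scaleL c).comp res1 := by
  apply Polynomial.ringHom_ext
  · intro a
    simp [scale_C, res1_C, scaleL]
  · simp [scale_X, res1_X, res1_C, scaleL]

lemma scale_comp (c d : R) : (scale c).comp (scale d) = scale (c * d) := by
  apply Polynomial.ringHom_ext
  · intro a
    simp [scale_C]
  · simp [scale_C, scale_X]; ring

lemma scale_one : scale (1 : R) = RingHom.id _ := by
  apply Polynomial.ringHom_ext
  · intro a
    simp [scale_C]
  · simp [scale_X]

lemma Subsheaf.ext {K L : Subsheaf R n} (h0 : K.K0 = L.K0) (h1 : K.K1 = L.K1) : K = L := by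
  cases K; cases L; simp_all

lemma map_scale (f : R →+* S) (c : R) :
    (mapRingHom f).comp (scale c) = (scale (f c)).comp (mapRingHom f) := by
  apply Polynomial.ringHom_ext
  · intro a
    simp [scale_C]
  · simp [scale_X]

lemma baseChange_baseChange {U : Type*} [CommRing U] (K : Subsheaf R n) (f : R →+* S)
    (f' : S →+* U) : (K.baseChange f).baseChange f' = K.baseChange (f'.comp f) := by
  apply Subsheaf.ext
  · simp only [Subsheaf.baseChange, push_push, mapRingHom_comp]
    congr 1
    ext j : 1
    simp
  · simp only [Subsheaf.baseChange, push_push, mapRingHom_comp]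
    congr 1
    ext j : 1
    simp

variable [Algebra ℂ R] [Algebra ℂ S]

/-- A nonzero complex number as a unit of a `ℂ`-algebra. -/
def unitOf (R : Type*) [CommRing R] [Algebra ℂ R] (c : ℂˣ) : Rˣ :=
  Units.map (algebraMap ℂ R).toMonoidHom c

lemma unitOf_inv (c : ℂˣ) : unitOf R c⁻¹ = (unitOf R c)⁻¹ := by simp [unitOf]

/-- The action of `(t, q)` in `T × ℂ*_q` on subsheaves of `𝒪 ^ n`: the diagonal matrix `t` acts on
`𝒪 ^ n = ℂⁿ ⊗ 𝒪`, and `q` acts by pull-back along `[x : y] ↦ [q x : y]`, so that a section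
`f (x / y)` becomes `t • f (q x / y)`. -/
def Subsheaf.act (g : Torus n) (K : Subsheaf R n) : Subsheaf R n where
  K0 := push (scale (unitOf R g.2 : R)) (fun j => Polynomial.C (unitOf R (g.1 j) : R)) K.K0
  K1 := push (scale (unitOf R g.2⁻¹ : R))
    (fun j => Polynomial.C (unitOf R (g.1 j) : R)) K.K1
  glue := by
    have h := congrArg (push (scaleL (unitOf R g.2))
      (fun j => LaurentPolynomial.C (unitOf R (g.1 j) : R))) K.glue
    rw [push_push, push_push, ← res0_scale, ← res1_scale] at h
    rw [push_push, push_push]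
    simpa [res0_C, res1_C, unitOf_inv] using h

lemma unitOf_mul (c d : ℂˣ) : unitOf R (c * d) = unitOf R c * unitOf R d := by simp [unitOf]
lemma unitOf_one : unitOf R 1 = 1 := by simp [unitOf]

lemma act_mul (g h : Torus n) (K : Subsheaf R n) : K.act (g * h) = (K.act h).act g := by
  apply Subsheaf.ext
  · simp only [Subsheaf.act, push_push, scale_comp, scale_C, Prod.snd_mul, Prod.fst_mul,
      Pi.mul_apply, unitOf_mul, Units.val_mul, map_mul]
  · simp only [Subsheaf.act, push_push, scale_comp, scale_C, Prod.snd_mul, Prod.fst_mul,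
      Pi.mul_apply, mul_inv, unitOf_mul, Units.val_mul, map_mul]

lemma act_one (K : Subsheaf R n) : K.act 1 = K := by
  apply Subsheaf.ext
  · convert push_id K.K0 using 1
    simp only [Subsheaf.act, Prod.snd_one, Prod.fst_one, Pi.one_apply, unitOf_one, Units.val_one,
      scale_one, map_one]
    rfl
  · convert push_id K.K1 using 1
    simp only [Subsheaf.act, Prod.snd_one, Prod.fst_one, Pi.one_apply, inv_one, unitOf_one,
      Units.val_one, scale_one, map_one]
    rfl

lemma act_baseChange (g : Torus n) (K : Subsheaf R n) (f : R →ₐ[ℂ] S) :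
    (K.act g).baseChange (f : R →+* S) = (K.baseChange (f : R →+* S)).act g := by
  have h (c : ℂˣ) : (f : R →+* S) (unitOf R c : R) = (unitOf S c : S) := by simp [unitOf]
  apply Subsheaf.ext
  · simp only [Subsheaf.act, Subsheaf.baseChange, push_push, map_scale, h]
    congr 1
    ext j : 1
    simp [h]
  · simp only [Subsheaf.act, Subsheaf.baseChange, push_push, map_scale, h]
    congr 1
    ext j : 1
    simp [h]

end Torus

/-! ### First-order deformations -/

section Deform

open TrivSqZeroExt DualNumber TensorProduct

variable {n : ℕ}

/-- The ring homomorphism `ℂ[ε] → ℂ`, `ε ↦ 0`. -/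
def red : ℂ[ε] →ₐ[ℂ] ℂ := fstHom ℂ ℂ ℂ

/-- Reduction modulo `ε` of polynomials over `ℂ[ε]`. -/
def redX : ℂ[ε][X] →+* ℂ[X] := mapRingHom (red : ℂ[ε] →+* ℂ)

/-- The inclusion of polynomials over `ℂ` into polynomials over `ℂ[ε]`. -/
def inlX : ℂ[X] →+* ℂ[ε][X] := mapRingHom (inlHom ℂ ℂ)

/-- The vector `a + ε b`. -/
def pair (a b : Fin n → ℂ[X]) : Fin n → ℂ[ε][X] :=
  fun j => inlX (a j) + Polynomial.C ε * inlX (b j)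

lemma red_eps : red ε = 0 := TrivSqZeroExt.fst_inr ℂ 1
lemma redX_inlX (a : ℂ[X]) : redX (inlX a) = a := by
  ext k
  simp [redX, inlX, red]
lemma redX_eps : redX (Polynomial.C ε) = 0 := by
  rw [redX, coe_mapRingHom, Polynomial.map_C]
  exact (congrArg Polynomial.C red_eps).trans Polynomial.C_0
lemma redX_pair (a b : Fin n → ℂ[X]) (j : Fin n) : redX (pair a b j) = a j := by
  rw [pair, map_add, map_mul, redX_eps, redX_inlX, zero_mul, add_zero]
lemma redX_surjective : Function.Surjective redX := fun a => ⟨inlX a, redX_inlX a⟩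

lemma dual_decomp (z : ℂ[ε]) : z = inlHom ℂ ℂ z.fst + ε * inlHom ℂ ℂ z.snd := by
  ext <;> simp

lemma exists_snd (F : ℂ[ε][X]) :
    ∃ b, F = inlX (redX F) + Polynomial.C ε * inlX b := by
  refine Polynomial.induction_on F ?_ ?_ ?_
  · intro z
    refine ⟨Polynomial.C z.snd, ?_⟩
    conv_lhs => rw [dual_decomp z]
    simp [inlX, redX, red]
  · rintro p q ⟨b, hb⟩ ⟨c, hc⟩
    refine ⟨b + c, ?_⟩
    conv_lhs => rw [hb, hc]
    simp only [map_add]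
    ring
  · rintro k z ⟨b, hb⟩
    refine ⟨b * X, ?_⟩
    have hX : inlX X = X := by simp [inlX]
    have hX' : redX X = X := by simp [redX]
    rw [pow_succ, ← mul_assoc, map_mul redX, hX', map_mul inlX, map_mul inlX, hX]
    conv_lhs => rw [hb]
    ring

lemma exists_pair (F : Fin n → ℂ[ε][X]) : ∃ b, F = pair (fun j => redX (F j)) b := by
  choose b hb using fun j => exists_snd (F j)
  exact ⟨b, funext hb⟩

lemma eps_mul_eps : (Polynomial.C ε * Polynomial.C ε : ℂ[ε][X]) = 0 := by
  rw [← Polynomial.C_mul, DualNumber.eps_mul_eps, Polynomial.C_0]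

lemma eps_inlX_injective {b c : ℂ[X]}
    (h : Polynomial.C ε * inlX b = Polynomial.C ε * inlX c) : b = c := by
  ext k
  have := congrArg (fun p : ℂ[ε][X] => (p.coeff k).snd) h
  simpa [inlX] using this

lemma pair_injective {a b a' b' : Fin n → ℂ[X]} (h : pair a b = pair a' b') :
    a = a' ∧ b = b' := by
  have ha : a = a' := by
    ext1 j
    rw [← redX_pair a b, h, redX_pair]
  subst ha
  refine ⟨rfl, ?_⟩
  ext1 j
  have := congrFun h j
  simp only [pair, add_right_inj] at this
  exact eps_inlX_injective this

lemma pair_add (a b a' b' : Fin n → ℂ[X]) :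
    pair (a + a') (b + b') = pair a b + pair a' b' := by
  ext1 j
  simp only [pair, Pi.add_apply, map_add]
  ring

lemma smul_pair (p r : ℂ[X]) (a b : Fin n → ℂ[X]) :
    (inlX p + Polynomial.C ε * inlX r) • pair a b = pair (p • a) (p • b + r • a) := by
  ext1 j
  simp only [pair, Pi.smul_apply, Pi.add_apply, smul_eq_mul, map_add, map_mul]
  linear_combination inlX r * inlX (b j) * eps_mul_eps

lemma eps_smul (F : Fin n → ℂ[ε][X]) :
    (ε : ℂ[ε]) • F = pair 0 (fun j => redX (F j)) := by
  obtain ⟨b, hb⟩ := exists_pair F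
  generalize (fun j => redX (F j)) = a at hb ⊢
  subst hb
  ext1 j
  simp only [pair, Pi.smul_apply, Polynomial.smul_eq_C_mul, Pi.zero_apply, map_zero]
  linear_combination inlX (b j) * eps_mul_eps

/-- For a submodule `K` of `ℂ[X] ^ n` and `φ : K → ℂ[X] ^ n / K`, the submodule
`{a + ε b | a ∈ K, b mod K = φ a}` of `ℂ[ε][X] ^ n`. -/
def deform (K : Submodule ℂ[X] (Fin n → ℂ[X])) (φ : K →ₗ[ℂ[X]] (Fin n → ℂ[X]) ⧸ K) :
    Submodule ℂ[ε][X] (Fin n → ℂ[ε][X]) where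
  carrier := {F | ∃ (a : K) (b : Fin n → ℂ[X]), F = pair a b ∧ K.mkQ b = φ a}
  add_mem' := by
    rintro _ _ ⟨a, b, rfl, h⟩ ⟨a', b', rfl, h'⟩
    exact ⟨a + a', b + b', by rw [← pair_add]; rfl, by rw [map_add, map_add, h, h']⟩
  zero_mem' := ⟨0, 0, by ext1 j; simp [pair], by simp⟩
  smul_mem' := by
    rintro p _ ⟨a, b, rfl, h⟩
    obtain ⟨s, hs⟩ := exists_snd p
    refine ⟨redX p • a, redX p • b + s • (a : Fin n → ℂ[X]), ?_, ?_⟩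
    · conv_lhs => rw [hs]
      rw [smul_pair]
      rfl
    · have : K.mkQ (s • (a : Fin n → ℂ[X])) = 0 := by
        rw [Submodule.mkQ_apply, Submodule.Quotient.mk_eq_zero]
        exact K.smul_mem s a.2
      rw [map_add, this, map_smul, map_smul, h, add_zero]

variable {K : Submodule ℂ[X] (Fin n → ℂ[X])} {φ : K →ₗ[ℂ[X]] (Fin n → ℂ[X]) ⧸ K}

lemma pair_mem_deform {a b : Fin n → ℂ[X]} :
    pair a b ∈ deform K φ ↔ ∃ h : a ∈ K, K.mkQ b = φ ⟨a, h⟩ := by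
  constructor
  · rintro ⟨a', b', h, h'⟩
    obtain ⟨rfl, rfl⟩ := pair_injective h
    exact ⟨a'.2, h'⟩
  · rintro ⟨h, h'⟩
    exact ⟨⟨a, h⟩, b, rfl, h'⟩

lemma exists_mem_deform (a : K) : ∃ b, pair a b ∈ deform K φ := by
  obtain ⟨b, hb⟩ := K.mkQ_surjective (φ a)
  exact ⟨b, pair_mem_deform.2 ⟨a.2, hb⟩⟩

lemma pair_zero_mem_deform {b : Fin n → ℂ[X]} : pair 0 b ∈ deform K φ ↔ b ∈ K := by
  rw [pair_mem_deform]
  constructor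
  · rintro ⟨h, h'⟩
    have : φ ⟨0, h⟩ = 0 := map_zero φ
    rw [this] at h'
    simpa using h'
  · intro h
    refine ⟨K.zero_mem, ?_⟩
    have : φ ⟨0, K.zero_mem⟩ = 0 := map_zero φ
    rw [this]
    simpa using h

lemma mem_push_redX {L : Submodule ℂ[ε][X] (Fin n → ℂ[ε][X])} {a : Fin n → ℂ[X]} :
    a ∈ push (A := ℂ[ε][X]) redX 1 L ↔ ∃ b, pair a b ∈ L := by
  rw [mem_push_of_surjective _ redX_surjective]
  constructor
  · rintro ⟨f, hf, rfl⟩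
    obtain ⟨b, hb⟩ := exists_pair f
    refine ⟨b, ?_⟩
    convert hf
    rw [hb]
    simp [redX_pair]
  · rintro ⟨b, hb⟩
    exact ⟨_, hb, by ext1 j; simp [redX_pair]⟩

lemma push_deform : push (A := ℂ[ε][X]) redX 1 (deform K φ) = K := by
  ext a
  rw [mem_push_redX]
  constructor
  · rintro ⟨b, hb⟩
    exact (pair_mem_deform.1 hb).1
  · intro ha
    exact exists_mem_deform ⟨a, ha⟩

/-- A module over `ℂ[ε]` is flat if and only if the kernel of `ε` is the image of `ε`. -/
lemma flat_iff {M : Type*} [AddCommGroup M] [Module ℂ[ε] M] :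
    Module.Flat ℂ[ε] M ↔ ∀ m : M, (ε : ℂ[ε]) • m = 0 → ∃ m', m = (ε : ℂ[ε]) • m' := by
  constructor
  · intro _ m hm
    obtain ⟨k, a, y, h1, h2⟩ := Module.Flat.isTrivialRelation_of_sum_smul_eq_zero
      (f := fun _ : Fin 1 => (ε : ℂ[ε])) (x := fun _ => m) (by simpa using hm)
    refine ⟨∑ j, (inlHom ℂ ℂ (a 0 j).snd) • y j, ?_⟩
    have h5 : m = ∑ j, a 0 j • y j := h1 0
    rw [h5, Finset.smul_sum]
    refine Finset.sum_congr rfl fun j _ => ?_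
    have h3 := h2 j
    simp only [Finset.univ_unique] at h3
    have h4 : (a 0 j).fst = 0 := by
      have := congrArg TrivSqZeroExt.snd h3
      simpa using this
    rw [smul_smul]
    congr 1
    conv_lhs => rw [dual_decomp (a 0 j), h4]
    simp
  · intro H
    rw [Module.Flat.iff_lift_lsmul_comp_subtype_injective]
    intro I _
    rw [injective_iff_map_eq_zero]
    obtain ⟨g, hg, rfl⟩ : ∃ g : ℂ[ε], (g = 0 ∨ g = ε ∨ g = 1) ∧ I = Ideal.span {g} := by
      rcases DualNumber.ideal_trichotomy I with rfl | rfl | rfl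
      · exact ⟨0, by simp, by simp⟩
      · exact ⟨ε, by simp, rfl⟩
      · exact ⟨1, by simp, by simp⟩
    have hg' : g ∈ Ideal.span {g} := Ideal.mem_span_singleton_self g
    intro z hz
    obtain ⟨m, rfl⟩ : ∃ m : M, z = (⟨g, hg'⟩ : Ideal.span {g}) ⊗ₜ[ℂ[ε]] m := by
      clear hz
      induction z using TensorProduct.induction_on with
      | zero => exact ⟨0, by simp⟩
      | tmul x m =>
        obtain ⟨c, hc⟩ := Ideal.mem_span_singleton'.1 x.2
        refine ⟨c • m, ?_⟩
        rw [← TensorProduct.smul_tmul]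
        congr 1
        exact Subtype.ext hc.symm
      | add x y hx hy =>
        obtain ⟨m, rfl⟩ := hx
        obtain ⟨m', rfl⟩ := hy
        exact ⟨m + m', (TensorProduct.tmul_add _ _ _).symm⟩
    have hz' : g • m = 0 := by simpa using hz
    rcases hg with rfl | rfl | rfl
    · have : (⟨0, hg'⟩ : Ideal.span {(0 : ℂ[ε])}) = 0 := rfl
      rw [this, TensorProduct.zero_tmul]
    · obtain ⟨m', rfl⟩ := H m hz'
      rw [← TensorProduct.smul_tmul]
      have : (ε : ℂ[ε]) • (⟨ε, hg'⟩ : Ideal.span {(ε : ℂ[ε])}) = 0 :=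
        Subtype.ext DualNumber.eps_mul_eps
      rw [this, TensorProduct.zero_tmul]
    · rw [one_smul] at hz'
      rw [hz', TensorProduct.tmul_zero]

/-- Flatness over `ℂ[ε]` of the quotient by a submodule of `ℂ[ε][X] ^ n`. -/
lemma flat_quotient_iff (L : Submodule ℂ[ε][X] (Fin n → ℂ[ε][X])) :
    Module.Flat ℂ[ε] ((Fin n → ℂ[ε][X]) ⧸ L) ↔
      ∀ b : Fin n → ℂ[X], pair 0 b ∈ L → ∃ c, pair b c ∈ L := by
  rw [flat_iff]
  constructor
  · intro H b hb
    have h0 : pair 0 b = (ε : ℂ[ε]) • pair b 0 := by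
      rw [eps_smul]
      simp only [redX_pair]
    rw [h0] at hb
    obtain ⟨m', hm'⟩ := H (Submodule.Quotient.mk (pair b 0)) (by
      rw [← Submodule.Quotient.mk_smul]
      exact (Submodule.Quotient.mk_eq_zero _).2 hb)
    obtain ⟨G, rfl⟩ := Submodule.Quotient.mk_surjective _ m'
    rw [← Submodule.Quotient.mk_smul, Submodule.Quotient.eq, eps_smul] at hm'
    refine ⟨- fun j => redX (G j), ?_⟩
    convert hm' using 1
    ext1 j
    simp only [pair, Pi.sub_apply, Pi.neg_apply, Pi.zero_apply, map_zero, map_neg]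
    ring
  · intro H m hm
    obtain ⟨F, rfl⟩ := Submodule.Quotient.mk_surjective _ m
    rw [← Submodule.Quotient.mk_smul, Submodule.Quotient.mk_eq_zero, eps_smul] at hm
    obtain ⟨c, hc⟩ := H _ hm
    obtain ⟨b, hb⟩ := exists_pair F
    refine ⟨Submodule.Quotient.mk (pair (b - c) 0), ?_⟩
    rw [← Submodule.Quotient.mk_smul, Submodule.Quotient.eq, eps_smul]
    simp only [redX_pair]
    convert hc using 1
    ext1 j
    have hj := congrFun hb j
    simp only [pair, Pi.sub_apply, Pi.zero_apply, map_zero, map_sub] at hj ⊢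
    linear_combination hj

lemma flat_deform : Module.Flat ℂ[ε] ((Fin n → ℂ[ε][X]) ⧸ deform K φ) := by
  rw [flat_quotient_iff]
  intro b hb
  exact exists_mem_deform ⟨b, pair_zero_mem_deform.1 hb⟩

/-- Every flat deformation of `K` is of the form `deform K φ`. -/
lemma exists_deform (L : Submodule ℂ[ε][X] (Fin n → ℂ[ε][X]))
    (hflat : Module.Flat ℂ[ε] ((Fin n → ℂ[ε][X]) ⧸ L))
    (hL : push (A := ℂ[ε][X]) redX 1 L = K) :
    ∃ φ : K →ₗ[ℂ[X]] (Fin n → ℂ[X]) ⧸ K, L = deform K φ := by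
  rw [flat_quotient_iff] at hflat
  have hK : ∀ a, a ∈ K ↔ ∃ b, pair a b ∈ L := fun a => by rw [← hL, mem_push_redX]
  have hK0 : ∀ b, pair 0 b ∈ L ↔ b ∈ K := by
    intro b
    constructor
    · intro hb
      exact (hK b).2 (hflat b hb)
    · intro hb
      obtain ⟨c, hc⟩ := (hK b).1 hb
      have := L.smul_mem (Polynomial.C ε) hc
      convert this using 1
      ext1 j
      simp only [pair, Pi.smul_apply, Pi.zero_apply, smul_eq_mul, map_zero]
      linear_combination -inlX (c j) * eps_mul_eps
  have hsub : ∀ {a b b' : Fin n → ℂ[X]}, pair a b ∈ L → pair a b' ∈ L → K.mkQ b = K.mkQ b' := by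
    intro a b b' h h'
    rw [← sub_eq_zero, ← map_sub, Submodule.mkQ_apply, Submodule.Quotient.mk_eq_zero, ← hK0]
    convert L.sub_mem h h' using 1
    ext1 j
    simp only [pair, Pi.sub_apply, Pi.zero_apply, map_zero, map_sub]
    ring
  choose s hs using fun a : K => (hK a).1 a.2
  refine ⟨{ toFun := fun a => K.mkQ (s a), map_add' := ?_, map_smul' := ?_ }, ?_⟩
  · intro a a'
    rw [← map_add]
    refine hsub (hs _) ?_
    rw [Submodule.coe_add, pair_add]
    exact L.add_mem (hs a) (hs a')
  · intro p a
    rw [RingHom.id_apply, ← map_smul]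
    refine hsub (hs _) ?_
    have := L.smul_mem (inlX p) (hs a)
    convert this using 1
    have h2 := smul_pair p 0 a (s a)
    simp only [map_zero, mul_zero, add_zero, zero_smul] at h2
    rw [h2]
    rfl
  · ext F
    obtain ⟨b, hb⟩ := exists_pair F
    rw [hb, pair_mem_deform]
    constructor
    · intro h
      have h1 := (hK _).2 ⟨b, h⟩
      exact ⟨h1, hsub h (hs ⟨_, h1⟩)⟩
    · rintro ⟨h1, h2⟩
      have h3 : b - s ⟨_, h1⟩ ∈ K := by
        rw [← Submodule.Quotient.mk_eq_zero, ← Submodule.mkQ_apply, map_sub, sub_eq_zero]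
        exact h2
      rw [← hK0] at h3
      have := L.add_mem h3 (hs ⟨_, h1⟩)
      rw [← pair_add] at this
      simpa using this

lemma deform_injective {φ ψ : K →ₗ[ℂ[X]] (Fin n → ℂ[X]) ⧸ K}
    (h : deform K φ ≤ deform K ψ) : φ = ψ := by
  ext1 a
  obtain ⟨b, hb⟩ := exists_mem_deform (φ := φ) a
  obtain ⟨_, h1⟩ := pair_mem_deform.1 hb
  obtain ⟨_, h2⟩ := pair_mem_deform.1 (h hb)
  exact h1.symm.trans h2

/-- The global homomorphisms from `K` to `𝒪 ^ n / K`: pairs of homomorphisms on the two charts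
that agree on the overlap. -/
def globalHom (K : Subsheaf ℂ n) :
    Submodule ℂ ((K.K0 →ₗ[ℂ[X]] (Fin n → ℂ[X]) ⧸ K.K0) × (K.K1 →ₗ[ℂ[X]] (Fin n → ℂ[X]) ⧸ K.K1)) where
  carrier := {φ | ∀ (m : ℤ) (a : K.K0) (a' : K.K1),
    (∀ j, res0 ((a : Fin n → ℂ[X]) j) = T m * res1 ((a' : Fin n → ℂ[X]) j)) →
    ∃ b b', K.K0.mkQ b = φ.1 a ∧ K.K1.mkQ b' = φ.2 a' ∧
      (fun j => res0 (b j) - T m * res1 (b' j)) ∈ K.K01}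
  add_mem' := by
    intro φ ψ hφ hψ m a a' h
    obtain ⟨b, b', h1, h2, h3⟩ := hφ m a a' h
    obtain ⟨c, c', h4, h5, h6⟩ := hψ m a a' h
    refine ⟨b + c, b' + c', by simp [← h1, ← h4], by simp [← h2, ← h5], ?_⟩
    convert K.K01.add_mem h3 h6 using 1
    ext1 j
    simp only [Pi.add_apply, map_add]
    ring
  zero_mem' := by
    intro m a a' h
    refine ⟨0, 0, by simp, by simp, ?_⟩
    convert K.K01.zero_mem using 1
    ext1 j
    simp
  smul_mem' := by
    intro c φ hφ m a a' h
    obtain ⟨b, b', h1, h2, h3⟩ := hφ m a a' h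
    refine ⟨c • b, c • b', ?_, ?_, ?_⟩
    · rw [Prod.smul_fst, LinearMap.smul_apply, ← h1]
      rfl
    · rw [Prod.smul_snd, LinearMap.smul_apply, ← h2]
      rfl
    · convert K.K01.smul_mem (LaurentPolynomial.C c) h3 using 1
      ext1 j
      simp only [Pi.smul_apply, Polynomial.smul_eq_C_mul, map_mul, res0_C, res1_C, smul_eq_mul]
      ring

lemma T_mul_T_neg {R : Type*} [CommRing R] (m : ℤ) : (T m * T (-m) : R[T;T⁻¹]) = 1 := by
  rw [← T_add]; simp

lemma mem_push_res0 {R : Type*} [CommRing R] (K : Submodule R[X] (Fin n → R[X]))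
    (g : Fin n → R[T;T⁻¹]) :
    g ∈ push res0 1 K ↔ ∃ (m : ℤ), ∃ f ∈ K, ∀ j, res0 (f j) = T m * g j := by
  constructor
  · intro hg
    obtain ⟨m, f, hf, h⟩ := (mem_push_of_localization res0 X (T (-1))
      (by rw [res0_X, T_mul_T_neg]) (fun b => by
        obtain ⟨m, a, ha⟩ := exists_T_pow b
        exact ⟨m, a, by rw [res0, ha, toLaurent_X, T_pow, mul_comm, mul_one]⟩) K g).1 hg
    exact ⟨m, f, hf, fun j => by rw [h, res0_X, T_pow, mul_one]⟩
  · rintro ⟨m, f, hf, h⟩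
    convert Submodule.smul_mem _ (T (-m)) (mem_push_of_mem res0 1 hf) using 1
    ext1 j
    simp only [Pi.smul_apply, Pi.one_apply, smul_eq_mul, h]
    linear_combination -g j * T_mul_T_neg (R := R) m

lemma mem_push_res1 {R : Type*} [CommRing R] (K : Submodule R[X] (Fin n → R[X]))
    (g : Fin n → R[T;T⁻¹]) :
    g ∈ push res1 1 K ↔ ∃ (m : ℤ), ∃ f ∈ K, ∀ j, res1 (f j) = T m * g j := by
  constructor
  · intro hg
    obtain ⟨m, f, hf, h⟩ := (mem_push_of_localization res1 X (T 1)
      (by rw [res1_X, mul_comm, T_mul_T_neg]) (fun b => by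
        obtain ⟨m, a, ha⟩ := exists_T_pow (invert b)
        refine ⟨m, a, ?_⟩
        have hb : invert (invert b) = b := involutive_invert b
        rw [res1_X, T_pow, res1, RingHom.comp_apply, ha]
        change invert (invert b * T (m : ℤ)) = _
        rw [map_mul, hb, invert_T, mul_comm]
        simp) K g).1 hg
    exact ⟨-m, f, hf, fun j => by rw [h, res1_X, T_pow]; simp⟩
  · rintro ⟨m, f, hf, h⟩
    convert Submodule.smul_mem _ (T (-m)) (mem_push_of_mem res1 1 hf) using 1
    ext1 j
    simp only [Pi.smul_apply, Pi.one_apply, smul_eq_mul, h]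
    linear_combination -g j * T_mul_T_neg (R := R) m

lemma res0_injective {R : Type*} [CommRing R] : Function.Injective (res0 (R := R)) :=
  toLaurent_injective
lemma res1_injective {R : Type*} [CommRing R] : Function.Injective (res1 (R := R)) :=
  (invert (R := R)).injective.comp toLaurent_injective

/-- The inclusion of Laurent polynomials over `ℂ` into Laurent polynomials over `ℂ[ε]`. -/
def inlL : ℂ[T;T⁻¹] →+* ℂ[ε][T;T⁻¹] := AddMonoidAlgebra.mapRingHom ℤ (inlHom ℂ ℂ)

lemma eps_inlL_injective {b b' c c' : ℂ[T;T⁻¹]}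
    (h : inlL b + LaurentPolynomial.C ε * inlL c = inlL b' + LaurentPolynomial.C ε * inlL c') :
    b = b' ∧ c = c' := by
  rw [← LaurentPolynomial.smul_eq_C_mul, ← LaurentPolynomial.smul_eq_C_mul] at h
  constructor
  · ext k
    have := congrArg (fun p : ℂ[ε][T;T⁻¹] => (p.coeff k).fst) h
    simpa [inlL] using this
  · ext k
    have := congrArg (fun p : ℂ[ε][T;T⁻¹] => (p.coeff k).snd) h
    simpa [inlL] using this

lemma res0_inlX (a : ℂ[X]) : res0 (inlX a) = inlL (res0 a) :=
  RingHom.congr_fun (map_res0 (inlHom ℂ ℂ)) a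
lemma res1_inlX (a : ℂ[X]) : res1 (inlX a) = inlL (res1 a) :=
  RingHom.congr_fun (map_res1 (inlHom ℂ ℂ)) a
lemma inlL_T (m : ℤ) : inlL (T m) = T m := mapL_T _ m

section Glue

variable {A B A' B' : Type*} [CommRing A] [CommRing B] [CommRing A'] [CommRing B']
  {K K' : Submodule A (Fin n → A)} {φ : K →ₗ[A] (Fin n → A) ⧸ K}
  {φ' : K' →ₗ[A] (Fin n → A) ⧸ K'} {r r' : A →+* A'} {s s' : B →+* B'}
  {L L' : Submodule B (Fin n → B)} {i : A →+* B} {i' : A' →+* B'} {e : B} {e' : B'}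
  {t : ℤ → A'} {t' : ℤ → B'}

lemma glue_le (hr : ∀ a, s (i a) = i' (r a)) (hr' : ∀ a, s' (i a) = i' (r' a))
    (he : s e = e') (he' : s' e = e')
    (ht : ∀ m, t m * t (-m) = 1) (ht' : ∀ m, i' (t m) = t' m)
    (hL : ∀ F ∈ L, ∃ (a : K) (b : Fin n → A),
      F = (fun j => i ((a : Fin n → A) j) + e * i (b j)) ∧ K.mkQ b = φ a)
    (hL' : ∀ (a : K') (b : Fin n → A), K'.mkQ b = φ' a →
      (fun j => i ((a : Fin n → A) j) + e * i (b j)) ∈ L')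
    (hL0 : ∀ c ∈ K', (fun j => e * i (c j)) ∈ L')
    (hloc : ∀ g, g ∈ push r' 1 K' → ∃ (m : ℤ), ∃ f ∈ K', ∀ j, r' (f j) = t m * g j)
    (hK : push r 1 K ≤ push r' 1 K')
    (hcompat : ∀ (m : ℤ) (a : K) (a' : K'),
      (∀ j, r ((a : Fin n → A) j) = t m * r' ((a' : Fin n → A) j)) →
      ∃ b b', K.mkQ b = φ a ∧ K'.mkQ b' = φ' a' ∧
        (fun j => r (b j) - t m * r' (b' j)) ∈ push r' 1 K') :
    push s 1 L ≤ push s' 1 L' := by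
  refine Submodule.span_le.2 ?_
  rintro _ ⟨_, hF, rfl⟩
  obtain ⟨a, b, rfl, hb⟩ := hL _ hF
  obtain ⟨m, a', ha', h1⟩ := hloc _ (hK (mem_push_of_mem r 1 a.2))
  have h2 : ∀ j, r ((a : Fin n → A) j) = t (-m) * r' (a' j) := by
    intro j
    simp only [h1, Pi.one_apply]
    linear_combination -r ((a : Fin n → A) j) * ht m
  obtain ⟨b₁, b', h3, h4, h5⟩ := hcompat (-m) a ⟨a', ha'⟩ h2
  have h6 : b - b₁ ∈ K := by
    rw [← Submodule.Quotient.mk_eq_zero, ← Submodule.mkQ_apply, map_sub, sub_eq_zero, hb, h3]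
  have h7 := Submodule.add_mem _ (hK (mem_push_of_mem r 1 h6)) h5
  obtain ⟨m', c, hc, h8⟩ := hloc _ h7
  have h9 := Submodule.add_mem _
    (Submodule.smul_mem _ (t' (-m)) (mem_push_of_mem s' 1 (hL' _ _ h4)))
    (Submodule.smul_mem _ (t' (-m')) (mem_push_of_mem s' 1 (hL0 c hc)))
  rw [SetLike.mem_coe]
  convert h9 using 1
  ext1 j
  have h8' := congrArg i' (h8 j)
  have h2' := congrArg i' (h2 j)
  have ht'' := congrArg i' (ht m')
  simp only [Pi.add_apply, Pi.smul_apply, Pi.one_apply, Pi.sub_apply, smul_eq_mul, map_add,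
    map_mul, map_sub, map_one, hr, hr', he, he', ht'] at h8' h2' ht'' ⊢
  linear_combination h2' - e' * t' (-m') * h8' -
    e' * (i' (r (b j)) - t' (-m) * i' (r' (b' j))) * ht''

lemma compat_of_glue (hr : ∀ a, s (i a) = i' (r a)) (hr' : ∀ a, s' (i a) = i' (r' a))
    (he : s e = e') (he' : s' e = e')
    (ht : ∀ m, t m * t (-m) = 1) (ht' : ∀ m, i' (t m) = t' m)
    (hinj : Function.Injective r')
    (hinj' : ∀ b c c' : A', i' b + e' * i' c = e' * i' c' → b = 0 ∧ c = c')
    (hL : ∀ (a : K), ∃ b : Fin n → A, K.mkQ b = φ a ∧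
      (fun j => i ((a : Fin n → A) j) + e * i (b j)) ∈ L)
    (hL' : ∀ (a : K'), ∃ b : Fin n → A, K'.mkQ b = φ' a ∧
      (fun j => i ((a : Fin n → A) j) + e * i (b j)) ∈ L')
    (hF : ∀ F ∈ L', ∃ c d : Fin n → A, F = (fun j => i (c j) + e * i (d j)) ∧ (c = 0 → d ∈ K'))
    (hloc : ∀ g, g ∈ push s' 1 L' → ∃ (m : ℤ), ∃ f ∈ L', ∀ j, s' (f j) = t' m * g j)
    (hle : push s 1 L ≤ push s' 1 L') (m : ℤ) (a : K) (a' : K')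
    (h : ∀ j, r ((a : Fin n → A) j) = t m * r' ((a' : Fin n → A) j)) :
    ∃ b b', K.mkQ b = φ a ∧ K'.mkQ b' = φ' a' ∧
        (fun j => r (b j) - t m * r' (b' j)) ∈ push r' 1 K' := by
  obtain ⟨b, hb0, hb⟩ := hL a
  obtain ⟨b', hb0', hb'⟩ := hL' a'
  refine ⟨b, b', hb0, hb0', ?_⟩
  have h1 := Submodule.sub_mem _ (hle (mem_push_of_mem s 1 hb))
    (Submodule.smul_mem _ (t' m) (mem_push_of_mem s' 1 hb'))
  obtain ⟨m', F, hF', h2⟩ := hloc _ h1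
  obtain ⟨c, d, rfl, hd⟩ := hF F hF'
  have h3 : ∀ j, r' (c j) = 0 ∧ r' (d j) = t m' * (r (b j) - t m * r' (b' j)) := by
    intro j
    apply hinj'
    have h2' := h2 j
    have h' := congrArg i' (h j)
    simp only [Pi.sub_apply, Pi.smul_apply, Pi.one_apply, one_mul, smul_eq_mul,
      map_add, map_mul, map_sub, hr, hr', he, he', ht'] at h2' h' ⊢
    linear_combination h2' + t' m' * h'
  have h4 : c = 0 := by
    ext1 j
    exact hinj ((h3 j).1.trans (map_zero r').symm)
  convert Submodule.smul_mem _ (t (-m')) (mem_push_of_mem r' 1 (hd h4)) using 1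
  ext1 j
  simp only [Pi.smul_apply, Pi.one_apply, smul_eq_mul, (h3 j).2]
  linear_combination -(r (b j) - t m * r' (b' j)) * ht m'

end Glue

lemma glue_deform_iff (K : Subsheaf ℂ n) (φ : K.K0 →ₗ[ℂ[X]] (Fin n → ℂ[X]) ⧸ K.K0)
    (φ' : K.K1 →ₗ[ℂ[X]] (Fin n → ℂ[X]) ⧸ K.K1) :
    push (A := ℂ[ε][X]) res0 1 (deform K.K0 φ) = push (A := ℂ[ε][X]) res1 1 (deform K.K1 φ') ↔
      (φ, φ') ∈ globalHom K := by
  have hT : ∀ m : ℤ, (T m * T (-m) : ℂ[T;T⁻¹]) = 1 := T_mul_T_neg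
  have hF : ∀ {K : Submodule ℂ[X] (Fin n → ℂ[X])} {φ : K →ₗ[ℂ[X]] (Fin n → ℂ[X]) ⧸ K},
      ∀ F ∈ deform K φ, ∃ c d : Fin n → ℂ[X], F = (fun j => inlX (c j) + Polynomial.C ε * inlX (d j)) ∧
        (c = 0 → d ∈ K) := by
    intro K φ F hF
    obtain ⟨d, hd⟩ := exists_pair F
    refine ⟨_, d, hd, fun hc => ?_⟩
    rw [hc] at hd
    rw [hd] at hF
    exact pair_zero_mem_deform.1 hF
  have hL : ∀ {K : Submodule ℂ[X] (Fin n → ℂ[X])} {φ : K →ₗ[ℂ[X]] (Fin n → ℂ[X]) ⧸ K},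
      ∀ a : K, ∃ b : Fin n → ℂ[X], K.mkQ b = φ a ∧
      (fun j => inlX ((a : Fin n → ℂ[X]) j) + Polynomial.C ε * inlX (b j)) ∈ deform K φ := by
    intro K φ a
    obtain ⟨b, hb⟩ := exists_mem_deform (φ := φ) a
    exact ⟨b, (pair_mem_deform.1 hb).2, hb⟩
  have hL0 : ∀ {K : Submodule ℂ[X] (Fin n → ℂ[X])} {φ : K →ₗ[ℂ[X]] (Fin n → ℂ[X]) ⧸ K},
      ∀ c ∈ K, (fun j => Polynomial.C ε * inlX (c j)) ∈ deform K φ := by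
    intro K φ c hc
    convert pair_zero_mem_deform (φ := φ).2 hc using 1
    ext1 j
    simp [pair]
  have hinj : ∀ b c c' : ℂ[T;T⁻¹], inlL b + LaurentPolynomial.C ε * inlL c =
      LaurentPolynomial.C ε * inlL c' → b = 0 ∧ c = c' := by
    intro b c c' h
    apply eps_inlL_injective
    rw [h, map_zero, zero_add]
  constructor
  · intro h m a a' hm
    obtain ⟨b, b', h1, h2, h3⟩ := compat_of_glue (t := T) (t' := T) (r := res0) (r' := res1)
      (s := res0) (s' := res1) res0_inlX res1_inlX
      (res0_C _) (res1_C _) hT inlL_T res1_injective hinj hL hL hF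
      (fun g => (mem_push_res1 _ g).1) h.le m a a' hm
    refine ⟨b, b', h1, h2, ?_⟩
    rw [Subsheaf.K01, K.glue]
    exact h3
  · intro h
    apply le_antisymm
    · refine glue_le (r := res0) (r' := res1) (t := T) (t' := T) res0_inlX res1_inlX (res0_C _) (res1_C _)
        hT inlL_T (fun F hF => hF) (fun a b hb => ⟨a, b, rfl, hb⟩) hL0
        (fun g => (mem_push_res1 _ g).1) K.glue.le ?_
      intro m a a' hm
      obtain ⟨b, b', h1, h2, h3⟩ := h m a a' hm
      rw [Subsheaf.K01, K.glue] at h3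
      exact ⟨b, b', h1, h2, h3⟩
    · refine glue_le (r := res1) (r' := res0) (t := T) (t' := T) res1_inlX res0_inlX (res1_C _) (res0_C _)
        hT inlL_T (fun F hF => hF) (fun a b hb => ⟨a, b, rfl, hb⟩) hL0
        (fun g => (mem_push_res0 _ g).1) K.glue.ge ?_
      intro m a a' hm
      obtain ⟨b, b', h1, h2, h3⟩ := h (-m) a' a (fun j => by
        rw [hm]; linear_combination -res0 ((a' : Fin n → ℂ[X]) j) * hT m)
      refine ⟨b', b, h2, h1, ?_⟩
      change _ ∈ K.K01
      convert Submodule.smul_mem _ (-T m) h3 using 1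
      ext1 j
      simp only [Pi.smul_apply, smul_eq_mul]
      linear_combination -res1 (b' j) * hT m

/-- The deformation of `K` over `ℂ[ε]` defined by a homomorphism `K → 𝒪 ^ n / K`. -/
def deformSheaf (K : Subsheaf ℂ n) (φ : globalHom K) : Subsheaf ℂ[ε] n where
  K0 := deform K.K0 φ.1.1
  K1 := deform K.K1 φ.1.2
  glue := (glue_deform_iff K _ _).2 φ.2

/-- The tangent space of the Quot scheme at a `ℂ`-point `x`: the set of `ℂ[ε]`-points of the Quot
scheme that reduce to `x` modulo `ε`. -/
def TangentSpace {r d : ℕ} (x : QuotPoint ℂ n r d) : Type :=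
  {u : QuotPoint ℂ[ε] n r d // u.1.baseChange (red : ℂ[ε] →+* ℂ) = x.1}

variable {r d : ℕ} {x : QuotPoint ℂ n r d}

lemma isQuot_deformation (u : Subsheaf ℂ[ε] n)
    (hu : u.baseChange (red : ℂ[ε] →+* ℂ) = x.1)
    (h0 : Module.Flat ℂ[ε] ((Fin n → ℂ[ε][X]) ⧸ u.K0))
    (h1 : Module.Flat ℂ[ε] ((Fin n → ℂ[ε][X]) ⧸ u.K1)) : IsQuot r d u where
  fg0 := IsNoetherian.noetherian _
  fg1 := IsNoetherian.noetherian _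
  flat0 := h0
  flat1 := h1
  hilbert := by
    intro k _ f
    have hf : f = (f.comp (inlHom ℂ ℂ)).comp (red : ℂ[ε] →+* ℂ) := by
      have h2 : f ε = 0 := by
        have : f ε * f ε = 0 := by rw [← map_mul, DualNumber.eps_mul_eps, map_zero]
        exact mul_self_eq_zero.1 this
      refine RingHom.ext fun z => ?_
      conv_lhs => rw [dual_decomp z]
      rw [map_add, map_mul, h2, zero_mul, add_zero]
      rfl
    rw [hf, ← baseChange_baseChange, hu]
    exact x.2.hilbert k _

variable (x) in
/-- The first-order deformation of a point of the Quot scheme defined by a homomorphism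
`K → 𝒪 ^ n / K`. -/
def ofHom (φ : globalHom x.1) : TangentSpace x :=
  have h : (deformSheaf x.1 φ).baseChange (red : ℂ[ε] →+* ℂ) = x.1 :=
    Subsheaf.ext push_deform push_deform
  ⟨⟨deformSheaf x.1 φ, isQuot_deformation _ h flat_deform flat_deform⟩, h⟩

lemma ofHom_bijective : Function.Bijective (ofHom x) := by
  constructor
  · intro φ ψ h
    have h' : deformSheaf x.1 φ = deformSheaf x.1 ψ := congrArg (fun u => u.1.1) h
    exact Subtype.ext (Prod.ext (deform_injective (congrArg Subsheaf.K0 h').le)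
      (deform_injective (congrArg Subsheaf.K1 h').le))
  · rintro ⟨⟨u, hu⟩, h⟩
    obtain ⟨φ, h0⟩ := exists_deform u.K0 hu.flat0 (congrArg Subsheaf.K0 h)
    obtain ⟨φ', h1⟩ := exists_deform u.K1 hu.flat1 (congrArg Subsheaf.K1 h)
    have hg := u.glue
    rw [h0, h1] at hg
    refine ⟨⟨(φ, φ'), (glue_deform_iff x.1 φ φ').1 hg⟩, ?_⟩
    exact Subtype.ext (Subtype.ext (Subsheaf.ext h0.symm h1.symm))

variable (x) in
/-- First-order deformations of the point `x` of the Quot scheme are in bijection with global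
homomorphisms `K → 𝒪 ^ n / K`. -/
def tangentEquiv : TangentSpace x ≃ globalHom x.1 := (Equiv.ofBijective _ ofHom_bijective).symm

/-- The vector space structure of the tangent space: `(a + ε b) + (a + ε b') = a + ε (b + b')` and
`c • (a + ε b) = a + ε (c b)`. -/
instance : AddCommGroup (TangentSpace x) := (tangentEquiv x).addCommGroup

instance : Module ℂ (TangentSpace x) := (tangentEquiv x).module ℂ

/-- The action of a diagonal matrix and a scaling of the coordinate on `ℂ[X] ^ n`. -/
def twist (c : ℂˣ) (t : Fin n → ℂˣ) (a : Fin n → ℂ[X]) : Fin n → ℂ[X] :=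
  fun j => Polynomial.C (t j : ℂ) * scale (c : ℂ) (a j)

lemma twist_add (c : ℂˣ) (t : Fin n → ℂˣ) (a b : Fin n → ℂ[X]) :
    twist c t (a + b) = twist c t a + twist c t b := by
  ext1 j
  simp only [twist, Pi.add_apply, map_add]
  ring

lemma twist_smul (c : ℂˣ) (t : Fin n → ℂˣ) (z : ℂ) (a : Fin n → ℂ[X]) :
    twist c t (z • a) = z • twist c t a := by
  ext1 j
  simp only [twist, Pi.smul_apply, Polynomial.smul_eq_C_mul, map_mul, scale_C]
  ring

lemma scale_bijective {R : Type*} [CommRing R] (c : Rˣ) :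
    Function.Bijective (scale (c : R)) := by
  have h1 : (scale ((c⁻¹ : Rˣ) : R)).comp (scale (c : R)) = RingHom.id _ := by
    rw [scale_comp, Units.inv_mul, scale_one]
  have h2 : (scale (c : R)).comp (scale ((c⁻¹ : Rˣ) : R)) = RingHom.id _ := by
    rw [scale_comp, Units.mul_inv, scale_one]
  exact ⟨Function.LeftInverse.injective (RingHom.congr_fun h1),
    Function.RightInverse.surjective (RingHom.congr_fun h2)⟩

lemma twist_eq_zero {c : ℂˣ} {t : Fin n → ℂˣ} {a : Fin n → ℂ[X]} (h : twist c t a = 0) :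
    a = 0 := by
  ext1 j
  have h1 := congrFun h j
  simp only [twist, Pi.zero_apply, mul_eq_zero, Polynomial.C_eq_zero, Units.ne_zero,
    false_or] at h1
  exact (scale_bijective c).1 (h1.trans (map_zero _).symm)

lemma scale_inlX (c : ℂˣ) (a : ℂ[X]) :
    scale (unitOf ℂ[ε] c : ℂ[ε]) (inlX a) = inlX (scale (c : ℂ) a) :=
  (RingHom.congr_fun (map_scale (inlHom ℂ ℂ) (c : ℂ)) a).symm

lemma C_unitOf (c : ℂˣ) :
    Polynomial.C (unitOf ℂ[ε] c : ℂ[ε]) = inlX (Polynomial.C (c : ℂ)) := by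
  rw [inlX, coe_mapRingHom, Polynomial.map_C]
  rfl

lemma twist_pair (c : ℂˣ) (t : Fin n → ℂˣ) (a b : Fin n → ℂ[X]) :
    (fun j => Polynomial.C (unitOf ℂ[ε] (t j) : ℂ[ε]) *
      scale (unitOf ℂ[ε] c : ℂ[ε]) (pair a b j)) = pair (twist c t a) (twist c t b) := by
  ext1 j
  rw [pair, map_add, map_mul, scale_inlX, scale_inlX, scale_C, C_unitOf, pair, twist, twist,
    map_mul, map_mul]
  ring

lemma mem_push_twist (c : ℂˣ) (t : Fin n → ℂˣ)
    (L : Submodule ℂ[ε][X] (Fin n → ℂ[ε][X])) (F : Fin n → ℂ[ε][X]) :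
    F ∈ push (A := ℂ[ε][X]) (B := ℂ[ε][X]) (scale (unitOf ℂ[ε] c : ℂ[ε]))
      (fun j => Polynomial.C (unitOf ℂ[ε] (t j) : ℂ[ε])) L ↔
      ∃ a b, pair a b ∈ L ∧ F = pair (twist c t a) (twist c t b) := by
  rw [mem_push_of_surjective _ (scale_bijective _).2]
  constructor
  · rintro ⟨f, hf, rfl⟩
    obtain ⟨b, hb⟩ := exists_pair f
    generalize (fun j => redX (f j)) = a at hb
    subst hb
    exact ⟨a, b, hf, twist_pair c t a b⟩
  · rintro ⟨a, b, h, rfl⟩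
    exact ⟨_, h, (twist_pair c t a b).symm⟩

lemma flat_twist (c : ℂˣ) (t : Fin n → ℂˣ) (L : Submodule ℂ[ε][X] (Fin n → ℂ[ε][X]))
    (h : Module.Flat ℂ[ε] ((Fin n → ℂ[ε][X]) ⧸ L)) :
    Module.Flat ℂ[ε] ((Fin n → ℂ[ε][X]) ⧸
      push (A := ℂ[ε][X]) (B := ℂ[ε][X]) (scale (unitOf ℂ[ε] c : ℂ[ε]))
        (fun j => Polynomial.C (unitOf ℂ[ε] (t j) : ℂ[ε])) L) := by
  rw [flat_quotient_iff] at h ⊢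
  intro b hb
  obtain ⟨a', b', h1, h2⟩ := (mem_push_twist _ _ _ _).1 hb
  obtain ⟨h3, rfl⟩ := pair_injective h2
  rw [twist_eq_zero h3.symm] at h1
  obtain ⟨d, hd⟩ := h _ h1
  exact ⟨_, (mem_push_twist _ _ _ _).2 ⟨_, _, hd, rfl⟩⟩

lemma ofHom_add (φ ψ : globalHom x.1) : ofHom x (φ + ψ) = ofHom x φ + ofHom x ψ := by
  have h : ∀ φ, (tangentEquiv x).symm φ = ofHom x φ := fun φ => rfl
  rw [← h, ← h, ← h, Equiv.add_def]
  simp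

lemma ofHom_smul (c : ℂ) (φ : globalHom x.1) : ofHom x (c • φ) = c • ofHom x φ := by
  have h : ∀ φ, (tangentEquiv x).symm φ = ofHom x φ := fun φ => rfl
  rw [← h, ← h, Equiv.smul_def]
  simp

lemma tangentSpace_ext {u v : TangentSpace x} (h0 : u.1.1.K0 ≤ v.1.1.K0)
    (h1 : u.1.1.K1 ≤ v.1.1.K1) : u = v := by
  obtain ⟨φ, rfl⟩ := ofHom_bijective.2 u
  obtain ⟨ψ, rfl⟩ := ofHom_bijective.2 v
  have : φ = ψ := Subtype.ext (Prod.ext (deform_injective h0) (deform_injective h1))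
  rw [this]

/-- The transform of a submodule of `ℂ[ε][X] ^ n` by a diagonal matrix and a scaling of `X`. -/
def twistD (c : ℂˣ) (t : Fin n → ℂˣ) (L : Submodule ℂ[ε][X] (Fin n → ℂ[ε][X])) :
    Submodule ℂ[ε][X] (Fin n → ℂ[ε][X]) :=
  push (A := ℂ[ε][X]) (B := ℂ[ε][X]) (scale (unitOf ℂ[ε] c : ℂ[ε]))
    (fun j => Polynomial.C (unitOf ℂ[ε] (t j) : ℂ[ε])) L

lemma twistD_deform_add {K : Submodule ℂ[X] (Fin n → ℂ[X])}
    {φ ψ φ' ψ' : K →ₗ[ℂ[X]] (Fin n → ℂ[X]) ⧸ K} {c : ℂˣ} {t : Fin n → ℂˣ}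
    (hφ : twistD c t (deform K φ) = deform K φ') (hψ : twistD c t (deform K ψ) = deform K ψ') :
    twistD c t (deform K (φ + ψ)) ≤ deform K (φ' + ψ') := by
  intro F hF
  obtain ⟨a, b, hab, rfl⟩ := (mem_push_twist _ _ _ _).1 hF
  obtain ⟨ha, hb⟩ := pair_mem_deform.1 hab
  obtain ⟨b₁, h₁⟩ := exists_mem_deform (φ := φ) ⟨a, ha⟩
  have h₂ : pair a (b - b₁) ∈ deform K ψ := by
    refine pair_mem_deform.2 ⟨ha, ?_⟩
    rw [map_sub, hb, (pair_mem_deform.1 h₁).2]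
    simp
  have h₃ : pair (twist c t a) (twist c t b₁) ∈ deform K φ' := by
    rw [← hφ]
    exact (mem_push_twist _ _ _ _).2 ⟨_, _, h₁, rfl⟩
  have h₄ : pair (twist c t a) (twist c t (b - b₁)) ∈ deform K ψ' := by
    rw [← hψ]
    exact (mem_push_twist _ _ _ _).2 ⟨_, _, h₂, rfl⟩
  obtain ⟨ha', h₃⟩ := pair_mem_deform.1 h₃
  refine pair_mem_deform.2 ⟨ha', ?_⟩
  have h₅ : twist c t b = twist c t b₁ + twist c t (b - b₁) := by
    rw [← twist_add, add_sub_cancel]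
  rw [h₅, map_add, h₃, (pair_mem_deform.1 h₄).2]
  rfl

lemma twistD_deform_smul {K : Submodule ℂ[X] (Fin n → ℂ[X])}
    {φ φ' : K →ₗ[ℂ[X]] (Fin n → ℂ[X]) ⧸ K} {c : ℂˣ} {t : Fin n → ℂˣ}
    (hφ : twistD c t (deform K φ) = deform K φ') (z : ℂ) :
    twistD c t (deform K (z • φ)) ≤ deform K (z • φ') := by
  intro F hF
  obtain ⟨a, b, hab, rfl⟩ := (mem_push_twist _ _ _ _).1 hF
  obtain ⟨ha, hb⟩ := pair_mem_deform.1 hab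
  obtain ⟨b₁, h₁⟩ := exists_mem_deform (φ := φ) ⟨a, ha⟩
  have h₂ : pair 0 (b - z • b₁) ∈ deform K φ := by
    refine pair_zero_mem_deform.2 ?_
    rw [← Submodule.Quotient.mk_eq_zero, ← Submodule.mkQ_apply, map_sub, hb,
      LinearMap.smul_apply, ← (pair_mem_deform.1 h₁).2, sub_eq_zero]
    rfl
  have h₃ : pair (twist c t a) (twist c t b₁) ∈ deform K φ' := by
    rw [← hφ]
    exact (mem_push_twist _ _ _ _).2 ⟨_, _, h₁, rfl⟩
  have h₄ : pair 0 (twist c t (b - z • b₁)) ∈ deform K φ' := by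
    rw [← hφ]
    refine (mem_push_twist _ _ _ _).2 ⟨_, _, h₂, ?_⟩
    congr 1
    ext1 j
    simp [twist]
  obtain ⟨ha', h₃⟩ := pair_mem_deform.1 h₃
  refine pair_mem_deform.2 ⟨ha', ?_⟩
  have h₅ : twist c t b = z • twist c t b₁ + twist c t (b - z • b₁) := by
    rw [← twist_smul, ← twist_add, add_sub_cancel]
  have h₆ : K.mkQ (twist c t (b - z • b₁)) = 0 := by
    rw [Submodule.mkQ_apply, Submodule.Quotient.mk_eq_zero]
    exact pair_zero_mem_deform.1 h₄
  rw [h₅, map_add, h₆, add_zero, LinearMap.smul_apply, ← h₃]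
  rfl

/-- The action of an element `g` of the torus that fixes `x` on the tangent space at `x`. -/
def tangentAct (g : Torus n) (hg : x.1.act g = x.1) (u : TangentSpace x) : TangentSpace x :=
  have h : (u.1.1.act g).baseChange (red : ℂ[ε] →+* ℂ) = x.1 := by
    rw [act_baseChange, u.2, hg]
  ⟨⟨u.1.1.act g, isQuot_deformation _ h (flat_twist g.2 g.1 _ u.1.2.flat0)
    (flat_twist g.2⁻¹ g.1 _ u.1.2.flat1)⟩, h⟩

variable (x) in
/-- The representation of the torus `T × ℂ*_q` on the tangent space of the Quot scheme at a point
`x` that is fixed by the torus. -/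
def tangentRep (hx : ∀ g : Torus n, x.1.act g = x.1) :
    Representation ℂ (Torus n) (TangentSpace x) where
  toFun g :=
    { toFun := tangentAct g (hx g)
      map_add' := by
        intro u v
        obtain ⟨φ, rfl⟩ := ofHom_bijective.2 u
        obtain ⟨ψ, rfl⟩ := ofHom_bijective.2 v
        obtain ⟨φ', hφ⟩ := ofHom_bijective.2 (tangentAct g (hx g) (ofHom x φ))
        obtain ⟨ψ', hψ⟩ := ofHom_bijective.2 (tangentAct g (hx g) (ofHom x ψ))
        rw [← hφ, ← hψ, ← ofHom_add, ← ofHom_add]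
        exact tangentSpace_ext
          (twistD_deform_add (congrArg (fun u => u.1.1.K0) hφ.symm)
            (congrArg (fun u => u.1.1.K0) hψ.symm))
          (twistD_deform_add (congrArg (fun u => u.1.1.K1) hφ.symm)
            (congrArg (fun u => u.1.1.K1) hψ.symm))
      map_smul' := by
        intro c u
        obtain ⟨φ, rfl⟩ := ofHom_bijective.2 u
        obtain ⟨φ', hφ⟩ := ofHom_bijective.2 (tangentAct g (hx g) (ofHom x φ))
        rw [← hφ, RingHom.id_apply, ← ofHom_smul, ← ofHom_smul]
        exact tangentSpace_ext
          (twistD_deform_smul (congrArg (fun u => u.1.1.K0) hφ.symm) c)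
          (twistD_deform_smul (congrArg (fun u => u.1.1.K1) hφ.symm) c) }
  map_one' := by
    ext1 u
    exact Subtype.ext (Subtype.ext (act_one _))
  map_mul' g h := by
    ext1 u
    exact Subtype.ext (Subtype.ext (act_mul g h _))

end Deform

/-! ### Characters and `λ_y`-classes of representations of the torus -/

section Characters

variable {n : ℕ}

/-- The character group of the torus: `(α, k)` stands for the character
`t_1 ^ α_1 ⋯ t_n ^ α_n q ^ k`. -/
abbrev Weight (n : ℕ) : Type := (Fin n → ℤ) × ℤ

/-- The value of a character. -/
def Weight.eval (w : Weight n) (g : Torus n) : ℂ :=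
  (((∏ i, g.1 i ^ w.1 i) * g.2 ^ w.2 : ℂˣ) : ℂ)

/-- The character `(t_j / t_i) q ^ k`. -/
def weight (i j : Fin n) (k : ℤ) : Weight n := (Pi.single j 1 - Pi.single i 1, k)

/-- The ring `K_{T × ℂ*_q}(pt) = ℤ[t_1^{±1}, …, t_n^{±1}, q^{±1}]`. -/
abbrev KRing (n : ℕ) : Type := AddMonoidAlgebra ℤ (Weight n)

variable {V : Type*} [AddCommGroup V] [Module ℂ V]

/-- The weight space of a representation of the torus. -/
def weightSpace (ρ : Representation ℂ (Torus n) V) (w : Weight n) : Submodule ℂ V :=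
  ⨅ g : Torus n, LinearMap.ker (ρ g - w.eval g • LinearMap.id)

/-- The character `∑ dim V_w [w]` of a representation of the torus. -/
def character (ρ : Representation ℂ (Torus n) V) : KRing n :=
  ∑ᶠ w : Weight n, AddMonoidAlgebra.single w (Module.finrank ℂ (weightSpace ρ w) : ℤ)

/-- The exterior power of a representation. -/
def exteriorRep (ρ : Representation ℂ (Torus n) V) (i : ℕ) :
    Representation ℂ (Torus n) (⋀[ℂ]^i V) where
  toFun g := exteriorPower.map i (ρ g)
  map_one' := by rw [map_one]; exact exteriorPower.map_id
  map_mul' g h := by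
    rw [map_mul, Module.End.mul_eq_comp, Module.End.mul_eq_comp, exteriorPower.map_comp]

/-- The class `λ_y(V) = ∑ y ^ i [⋀ ^ i V]` in `K_{T × ℂ*_q}(pt)[y]`. -/
def lambdaY (ρ : Representation ℂ (Torus n) V) : (KRing n)[X] :=
  ∑ i ∈ Finset.range (Module.finrank ℂ V + 1),
    X ^ i * Polynomial.C (character (exteriorRep ρ i))

/-- The factor `1 + y w` of a `λ_y`-class. -/
def factor (w : Weight n) : (KRing n)[X] := 1 + X * Polynomial.C (AddMonoidAlgebra.single w 1)

end Characters

/-! ### Torus-fixed points -/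

section FixedPoint

variable {n : ℕ}

/-- The submodule `⨁_{i ∈ δ} (X ^ e_i) ⊆ ℂ[X] ^ n`. -/
def monomialChart (δ : Finset (Fin n)) (e : Fin n → ℕ) : Submodule ℂ[X] (Fin n → ℂ[X]) :=
  Submodule.pi Set.univ (fun i => if i ∈ δ then Ideal.span {X ^ e i} else ⊥)

/-- `K` is the image of `⨁_{i ∈ δ} ℂ_{t_i} ⊗ 𝒪(- a_i - b_i) → ℂⁿ ⊗ 𝒪` given by the monomials
`x ^ a_i y ^ b_i`: on the chart with coordinate `x / y` the `i`-th summand is generated by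
`(x / y) ^ a_i`, and on the chart with coordinate `y / x` by `(y / x) ^ b_i`. -/
def IsMonomial (K : Subsheaf ℂ n) (δ : Finset (Fin n)) (a b : Fin n → ℕ) : Prop :=
  K.K0 = monomialChart δ a ∧ K.K1 = monomialChart δ b

/-- The list, with multiplicities, of the weights of the tangent space at a fixed point. -/
def tangentWeights (δ : Finset (Fin n)) (a b : Fin n → ℕ) : Multiset (Weight n) :=
  (∑ i ∈ δ, ∑ j ∈ δᶜ, (Finset.range (a i + b i + 1)).val.map
    fun s : ℕ => weight i j (-(a i : ℤ) + s)) +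
  (∑ i ∈ δ, ((Finset.range (a i + b i + 1)).erase (a i)).val.map
    fun s : ℕ => weight i i (-(a i : ℤ) + s)) +
  (∑ p ∈ δ.offDiag, (Finset.Icc (-(a p.1 : ℤ)) (-(a p.1 : ℤ) + a p.2 - 1)).val.map
    fun s : ℤ => weight p.1 p.2 s) +
  (∑ p ∈ δ.offDiag, (Finset.Icc ((b p.1 : ℤ) - b p.2 + 1) (b p.1 : ℤ)).val.map
    fun s : ℤ => weight p.1 p.2 s)

end FixedPoint

end QuotP1

end

/-!
The tangent space at a point with kernel `K` is `Hom(K, 𝒪 ^ n / K)` (`tangentEquiv`). At a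
torus-fixed point `K` is a direct sum of line bundles `𝒪(- a_i - b_i)` with `i ∈ δ`, each embedded
in its own copy of `𝒪` by a monomial, so that the tangent space splits as the sum over `i ∈ δ` and
all `j` of `Hom(𝒪(- a_i - b_i), 𝒪)` for `j ∉ δ`, and of
`Hom(𝒪(- a_i - b_i), 𝒪 / (x ^ a_j y ^ b_j))` for `j ∈ δ`. The first space is `H⁰(𝒪(a_i + b_i))`,
with a basis of `a_i + b_i + 1` monomials. The second one consists of two stalks, at `x = 0` and at
`y = 0`, with bases of `a_j` and `b_j` monomials, because the torsion sheaf vanishes on the overlap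
of the two charts.

In concrete terms, `K` is free on either chart (`chartBasis`), and a global homomorphism is
determined by finitely many coefficients of the images of the generators (`homCoord`). These
coefficients can be prescribed arbitrarily (`homCoord_injective`, `homCoord_surjective`): on the
overlap there is no condition in the torsion summands (`mem_push_res0_monomialChart`), and in the
others the two local sections must be the two expressions of one section of `𝒪(a_i + b_i)`. The
torus multiplies every coefficient by a character (`tangentCoord_tangentRep`), hence the basis dual
to the coefficients consists of weight vectors. The weights are those in the list
(`map_homWeight`), where for `i = j` the two stalks together give the powers `q ^ (-a_i + s)` with
`s ≠ a_i`.

For the `λ_y`-class, the wedge products of weight vectors form a basis of weight vectors of the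
exterior powers, which gives `λ_y(V) = ∏ (1 + y w)` over the weights `w` of `V`
(`lambdaY_eq_prod`). The weights of the dual are the inverses of those of the tangent space.
-/

noncomputable section

namespace QuotP1

/-! ### Characters of the torus -/

section Weights

variable {n : ℕ}

lemma Weight.eval_zero (g : Torus n) : (0 : Weight n).eval g = 1 := by simp [Weight.eval]

lemma Weight.eval_add (w w' : Weight n) (g : Torus n) :
    (w + w').eval g = w.eval g * w'.eval g := by
  simp only [Weight.eval, Prod.fst_add, Prod.snd_add, Pi.add_apply, zpow_add,
    Finset.prod_mul_distrib, Units.val_mul]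
  ring

lemma Weight.eval_neg (w : Weight n) (g : Torus n) : (-w).eval g = w.eval g⁻¹ := by
  simp [Weight.eval]

lemma Weight.eval_sum {ι : Type*} (s : Finset ι) (w : ι → Weight n) (g : Torus n) :
    (∑ k ∈ s, w k).eval g = ∏ k ∈ s, (w k).eval g := by
  classical
  induction s using Finset.induction_on with
  | empty => simp [Weight.eval_zero]
  | insert k s hk ih => rw [Finset.sum_insert hk, Finset.prod_insert hk, Weight.eval_add, ih]

/-- Distinct elements of the character lattice are distinct functions on the torus: the values at
the points with one coordinate `2` and all others `1` determine the exponents. -/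
lemma Weight.eval_injective : Function.Injective (Weight.eval (n := n)) := by
  have h2 : ∀ k l : ℤ, (2 : ℂ) ^ k = 2 ^ l → k = l := fun k l h => by
    have h' := congrArg norm h
    simp only [norm_zpow, Complex.norm_ofNat] at h'
    exact zpow_right_injective₀ (by norm_num) (by norm_num) h'
  let u : ℂˣ := Units.mk0 2 two_ne_zero
  intro w w' h
  refine Prod.ext (funext fun i => h2 _ _ ?_) (h2 _ _ ?_)
  · have := congrFun h (Pi.mulSingle i u, 1)
    have key (v : Weight n) : v.eval (Pi.mulSingle i u, 1) = 2 ^ v.1 i := by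
      rw [Weight.eval, Finset.prod_eq_single i]
      · simp [u]
      · intro j _ hj
        simp [hj]
      · simp
    rwa [key, key] at this
  · have := congrFun h (1, u)
    simpa [Weight.eval, u] using this

lemma Weight.eval_weight (i j : Fin n) (k : ℤ) (g : Torus n) :
    (weight i j k).eval g = g.1 j * (g.1 i : ℂ)⁻¹ * (g.2 : ℂ) ^ k := by
  simp only [Weight.eval, weight, Pi.sub_apply, zpow_sub, Finset.prod_mul_distrib,
    Finset.prod_inv_distrib]
  rw [Finset.prod_eq_single j, Finset.prod_eq_single i]
  · simp
  all_goals simp +contextual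

lemma neg_weight (i j : Fin n) (k : ℤ) : -weight i j k = weight j i (-k) := by
  simp [weight]

end Weights

/-! ### Representations with a basis of weight vectors -/

section EigenBasis

variable {n : ℕ} {V : Type*} [AddCommGroup V] [Module ℂ V] {ι : Type*}
  {ρ : Representation ℂ (Torus n) V}

lemma mem_weightSpace {w : Weight n} {v : V} :
    v ∈ weightSpace ρ w ↔ ∀ g, ρ g v = w.eval g • v := by
  simp [weightSpace, sub_eq_zero]

/-- A weight space is spanned by the vectors of that weight in a basis of weight vectors. -/
lemma weightSpace_eq_span (b : Module.Basis ι ℂ V) (w : ι → Weight n)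
    (h : ∀ g k, ρ g (b k) = (w k).eval g • b k) (μ : Weight n) :
    weightSpace ρ μ = Submodule.span ℂ (Set.range fun k : {k // w k = μ} => b k) := by
  have hr : (Set.range fun k : {k // w k = μ} => b k) = b '' {k | w k = μ} := by
    ext; simp
  rw [hr]
  apply le_antisymm
  · intro v hv
    rw [mem_weightSpace] at hv
    rw [Module.Basis.mem_span_image]
    intro k hk
    by_contra hne
    obtain ⟨g, hg⟩ : ∃ g, (w k).eval g ≠ μ.eval g := by
      by_contra! h'
      exact hne (Weight.eval_injective (funext h'))
    -- The `k`-th coordinate of `ρ g v` is that of `v` times `w k`, and also times `μ`.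
    have hcoord : b.coord k ∘ₗ ρ g = (w k).eval g • b.coord k := by
      refine b.ext fun l => ?_
      by_cases hl : l = k
      · subst hl; simp [h]
      · simp [h, hl]
    have h1 := LinearMap.congr_fun hcoord v
    simp only [LinearMap.comp_apply, hv, map_smul, LinearMap.smul_apply, smul_eq_mul] at h1
    have h2 : b.coord k v ≠ 0 := by simpa using hk
    exact hg (mul_right_cancel₀ h2 h1).symm
  · rw [Submodule.span_le]
    rintro _ ⟨k, rfl, rfl⟩
    exact mem_weightSpace.2 fun g => h g k

lemma character_eq_sum [Fintype ι] (b : Module.Basis ι ℂ V) (w : ι → Weight n)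
    (h : ∀ g k, ρ g (b k) = (w k).eval g • b k) :
    character ρ = ∑ k, AddMonoidAlgebra.single (w k) 1 := by
  classical
  have hdim (μ : Weight n) : Module.finrank ℂ (weightSpace ρ μ) = Fintype.card {k // w k = μ} := by
    rw [weightSpace_eq_span b w h]
    exact finrank_span_eq_card (b.linearIndependent.comp _ Subtype.val_injective)
  rw [character, finsum_eq_sum_of_support_subset (s := Finset.univ.image w)]
  · rw [← Finset.sum_fiberwise_of_maps_to (t := Finset.univ.image w) (g := w) (by simp)]
    refine Finset.sum_congr rfl fun μ _ => ?_
    rw [Finset.sum_congr rfl (g := fun _ => AddMonoidAlgebra.single μ (1 : ℤ))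
      (by simp +contextual), hdim, Finset.sum_const, Fintype.card_subtype,
      AddMonoidAlgebra.smul_single]
    simp
  · intro μ hμ
    by_contra h'
    refine hμ ?_
    have : IsEmpty {k // w k = μ} := ⟨fun k => h' (by simp [← k.2])⟩
    simp [hdim]

lemma dual_apply_dualBasis [Finite ι] [DecidableEq ι] (b : Module.Basis ι ℂ V) (w : ι → Weight n)
    (h : ∀ g k, ρ g (b k) = (w k).eval g • b k) (g : Torus n) (k : ι) :
    ρ.dual g (b.dualBasis k) = (-w k).eval g • b.dualBasis k := by
  refine b.ext fun l => ?_
  simp only [Representation.dual_apply, Module.Dual.transpose_apply, LinearMap.comp_apply, h,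
    map_smul, LinearMap.smul_apply, Module.Basis.dualBasis_apply_self, Weight.eval_neg]
  by_cases hl : l = k
  · subst hl; rfl
  · simp [hl]

lemma prod_single {ι : Type*} (s : Finset ι) (w : ι → Weight n) :
    ∏ k ∈ s, (AddMonoidAlgebra.single (w k) 1 : KRing n) =
      AddMonoidAlgebra.single (∑ k ∈ s, w k) 1 := by
  classical
  induction s using Finset.induction_on with
  | empty => rfl
  | insert k s hk ih =>
    rw [Finset.prod_insert hk, Finset.sum_insert hk, ih,
      AddMonoidAlgebra.single_mul_single, one_mul]

lemma exteriorRep_apply_basis [LinearOrder ι] (b : Module.Basis ι ℂ V) (w : ι → Weight n)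
    (h : ∀ g k, ρ g (b k) = (w k).eval g • b k) (i : ℕ) (g : Torus n) (s : Set.powersetCard ι i) :
    exteriorRep ρ i g (b.exteriorPower i s) =
      (∑ k ∈ (s : Finset ι), w k).eval g • b.exteriorPower i s := by
  rw [exteriorPower.basis_apply, exteriorPower.ιMulti_family]
  change exteriorPower.map i (ρ g) _ = _
  rw [exteriorPower.map_apply_ιMulti]
  have h1 : (ρ g ∘ fun j => b (Set.powersetCard.ofFinEmbEquiv.symm s j)) =
      fun j => (w (Set.powersetCard.ofFinEmbEquiv.symm s j)).eval g •
        b (Set.powersetCard.ofFinEmbEquiv.symm s j) := funext fun j => h _ _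
  rw [Weight.eval_sum]
  have h2 : ∏ k ∈ (s : Finset ι), (w k).eval g =
      ∏ j, (w (Set.powersetCard.ofFinEmbEquiv.symm s j)).eval g := by
    conv_lhs => rw [← Finset.map_orderEmbOfFin_univ (s : Finset ι) s.2, Finset.prod_map]
    rfl
  rw [h2, ← AlternatingMap.map_smul_univ]
  exact congrArg _ h1

/-- The elementary symmetric functions of the weights are the characters of the exterior powers,
so that `λ_y` of a direct sum of lines is the product of the factors `1 + y w`. -/
lemma lambdaY_eq_prod [Fintype ι] (b : Module.Basis ι ℂ V) (w : ι → Weight n)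
    (h : ∀ g k, ρ g (b k) = (w k).eval g • b k) :
    lambdaY ρ = ∏ k, factor (w k) := by
  classical
  -- The basis of an exterior power needs an order on the index set, and any order will do.
  let : LinearOrder ι := LinearOrder.lift' (Fintype.equivFin ι) (Fintype.equivFin ι).injective
  have hchar (i : ℕ) : character (exteriorRep ρ i) =
      ∑ s ∈ Finset.univ.powersetCard i, AddMonoidAlgebra.single (∑ k ∈ s, w k) 1 := by
    rw [character_eq_sum (b.exteriorPower i) _ fun g s => exteriorRep_apply_basis b w h i g s]
    refine (Finset.sum_subtype _ (fun s => ?_)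
      fun s : Finset ι => (AddMonoidAlgebra.single (∑ k ∈ s, w k) 1 : KRing n)).symm
    simp [Set.powersetCard.mem_iff]
  simp only [lambdaY, factor, Finset.prod_one_add, Finset.sum_powerset,
    Module.finrank_eq_card_basis b, Finset.card_univ, hchar, map_sum, Finset.mul_sum]
  refine Finset.sum_congr rfl fun i _ => Finset.sum_congr rfl fun s hs => ?_
  rw [Finset.prod_mul_distrib, Finset.prod_const, (Finset.mem_powersetCard.1 hs).2,
    ← map_prod, prod_single]

end EigenBasis

/-! ### Homomorphisms on one chart -/

section Chart

variable {n : ℕ} {δ : Finset (Fin n)} {e : Fin n → ℕ} {L : Submodule ℂ[X] (Fin n → ℂ[X])}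

lemma mem_monomialChart {f : Fin n → ℂ[X]} :
    f ∈ monomialChart δ e ↔ (∀ j ∈ δ, X ^ e j ∣ f j) ∧ ∀ j ∉ δ, f j = 0 := by
  rw [monomialChart, Submodule.mem_pi]
  constructor
  · refine fun h => ⟨fun j hj => ?_, fun j hj => ?_⟩
    · simpa [hj, Ideal.mem_span_singleton] using h j trivial
    · simpa [hj] using h j trivial
  · rintro ⟨h, h'⟩ j -
    by_cases hj : j ∈ δ
    · simpa [hj, Ideal.mem_span_singleton] using h j hj
    · simpa [hj] using h' j hj

lemma single_mem_monomialChart {i : Fin n} (hi : i ∈ δ) :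
    (Pi.single i (X ^ e i) : Fin n → ℂ[X]) ∈ monomialChart δ e := by
  refine mem_monomialChart.2 ⟨fun j _ => ?_, fun j hj => ?_⟩
  · by_cases h : j = i
    · subst h; simp
    · simp [h]
  · have h : j ≠ i := fun h => hj (h ▸ hi)
    simp [h]

/-- The generator of the `i`-th summand of a monomial submodule. -/
def chartGen (hL : L = monomialChart δ e) (i : δ) : L :=
  ⟨Pi.single (i : Fin n) (X ^ e i), by rw [hL]; exact single_mem_monomialChart i.2⟩

lemma sum_smul_chartGen_apply (hL : L = monomialChart δ e) (p : δ → ℂ[X]) (i : δ) :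
    ((∑ k, p k • chartGen hL k : L) : Fin n → ℂ[X]) i = p i * X ^ e i := by
  simp only [Submodule.coe_sum, Submodule.coe_smul, chartGen, Finset.sum_apply, Pi.smul_apply,
    smul_eq_mul]
  rw [Finset.sum_eq_single i]
  · simp
  · intro k _ hk
    have : (i : Fin n) ≠ k := fun h => hk (Subtype.ext h.symm)
    simp [this]
  · simp

/-- A monomial submodule is free on its generators. -/
def chartBasis (hL : L = monomialChart δ e) : Module.Basis δ ℂ[X] L :=
  Module.Basis.mk (v := chartGen hL)
    (by
      refine Fintype.linearIndependent_iff.2 fun p hp i => ?_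
      have h := sum_smul_chartGen_apply hL p i
      rw [hp] at h
      simpa using h.symm)
    (by
      rintro ⟨f, hf⟩ -
      rw [hL, mem_monomialChart] at hf
      choose p hp using fun i : δ => hf.1 i i.2
      have : (⟨f, by rwa [hL, mem_monomialChart]⟩ : L) = ∑ i, p i • chartGen hL i := by
        refine Subtype.ext (funext fun j => ?_)
        by_cases hj : j ∈ δ
        · rw [sum_smul_chartGen_apply hL p ⟨j, hj⟩, mul_comm]
          exact hp ⟨j, hj⟩
        · have h0 (i : δ) : j ≠ i := fun h => hj (h ▸ i.2)
          change f j = _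
          simp [hf.2 j hj, chartGen, h0]
      rw [this]
      exact Submodule.sum_mem _ fun i _ => Submodule.smul_mem _ _ (Submodule.subset_span ⟨i, rfl⟩))

@[simp]
lemma chartBasis_apply (hL : L = monomialChart δ e) (i : δ) :
    chartBasis hL i = chartGen hL i := by simp [chartBasis]

lemma constr_chartBasis_chartGen {M : Type*} [AddCommGroup M] [Module ℂ M] [Module ℂ[X] M]
    [IsScalarTower ℂ ℂ[X] M] (hL : L = monomialChart δ e) (f : δ → M) (i : δ) :
    (chartBasis hL).constr ℂ f (chartGen hL i) = f i := by
  rw [← chartBasis_apply, Module.Basis.constr_basis]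

lemma apply_eq_repr_mul (hL : L = monomialChart δ e) (f : L) (i : δ) :
    (f : Fin n → ℂ[X]) i = (chartBasis hL).repr f i * X ^ e i := by
  conv_lhs => rw [← (chartBasis hL).sum_repr f]
  simp only [chartBasis_apply]
  exact sum_smul_chartGen_apply hL _ i

lemma coeff_eq_zero_of_mem (hL : L = monomialChart δ e) {j : Fin n} {s : ℕ}
    (hs : j ∈ δ → s < e j) {f : Fin n → ℂ[X]} (hf : f ∈ L) : (f j).coeff s = 0 := by
  rw [hL, mem_monomialChart] at hf
  by_cases hj : j ∈ δ
  · exact X_pow_dvd_iff.1 (hf.1 j hj) s (hs hj)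
  · simp [hf.2 j hj]

/-- Those coefficients of a vector of polynomials that are determined by its class modulo a
monomial submodule. -/
def quotCoeff (hL : L = monomialChart δ e) (j : Fin n) (s : ℕ) (hs : j ∈ δ → s < e j) :
    ((Fin n → ℂ[X]) ⧸ L) →ₗ[ℂ] ℂ :=
  (Submodule.liftQ (L.restrictScalars ℂ) (Polynomial.lcoeff ℂ s ∘ₗ
      (LinearMap.proj j : (Fin n → ℂ[X]) →ₗ[ℂ] ℂ[X]))
    (fun _ hf => coeff_eq_zero_of_mem hL hs hf)) ∘ₗ
    (Submodule.Quotient.restrictScalarsEquiv ℂ L).symm.toLinearMap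

lemma quotCoeff_mkQ (hL : L = monomialChart δ e) (j : Fin n) (s : ℕ) (hs : j ∈ δ → s < e j)
    (f : Fin n → ℂ[X]) : quotCoeff hL j s hs (L.mkQ f) = (f j).coeff s := rfl

/-- The coefficient of `X ^ s` in the `j`-th component of the image of the `i`-th generator under
a homomorphism from a monomial submodule to the quotient by it. -/
def chartCoord (hL : L = monomialChart δ e) (i : δ) (j : Fin n) (s : ℕ) (hs : j ∈ δ → s < e j) :
    (L →ₗ[ℂ[X]] (Fin n → ℂ[X]) ⧸ L) →ₗ[ℂ] ℂ where
  toFun φ := quotCoeff hL j s hs (φ (chartGen hL i))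
  map_add' φ ψ := by rw [LinearMap.add_apply, map_add]
  map_smul' c φ := by rw [LinearMap.smul_apply, map_smul, RingHom.id_apply]

lemma chartCoord_eq (hL : L = monomialChart δ e) {i : δ} (j : Fin n) (s : ℕ)
    (hs : j ∈ δ → s < e j) {φ : L →ₗ[ℂ[X]] (Fin n → ℂ[X]) ⧸ L} {b : Fin n → ℂ[X]}
    (h : L.mkQ b = φ (chartGen hL i)) : chartCoord hL i j s hs φ = (b j).coeff s := by
  change quotCoeff hL j s hs (φ (chartGen hL i)) = _
  rw [← h, quotCoeff_mkQ]

lemma coeff_scale (c : ℂ) (p : ℂ[X]) (s : ℕ) : (scale c p).coeff s = c ^ s * p.coeff s := by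
  have : scale c p = p.comp (Polynomial.C c * X) := rfl
  rw [this, comp_C_mul_X_coeff, mul_comm]

/-- The torus scales the coordinates of a homomorphism. The `i`-th generator is scaled by
`t_i c ^ e_i` and the monomial `X ^ s` in the `j`-th component by `t_j c ^ s`. -/
lemma chartCoord_twistD (hL : L = monomialChart δ e) {φ φ' : L →ₗ[ℂ[X]] (Fin n → ℂ[X]) ⧸ L}
    {c : ℂˣ} {t : Fin n → ℂˣ} (h : twistD c t (deform L φ) = deform L φ') (i : δ) (j : Fin n)
    (s : ℕ) (hs : j ∈ δ → s < e j) :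
    (t i * c ^ e i : ℂ) * chartCoord hL i j s hs φ' =
      (t j * c ^ s : ℂ) * chartCoord hL i j s hs φ := by
  obtain ⟨b, hb⟩ := exists_mem_deform (φ := φ) (chartGen hL i)
  have h1 : pair (twist c t (chartGen hL i)) (twist c t b) ∈ deform L φ' := by
    rw [← h]
    exact (mem_push_twist _ _ _ _).2 ⟨_, _, hb, rfl⟩
  have htw : twist c t (chartGen hL i) =
      (t i * c ^ e i : ℂ) • (chartGen hL i : Fin n → ℂ[X]) := by
    ext1 j
    by_cases hj : j = i
    · subst hj
      simp [twist, chartGen, scale_X, mul_pow, mul_assoc, Polynomial.smul_eq_C_mul]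
    · simp [twist, chartGen, hj]
  obtain ⟨hmem, h2⟩ := pair_mem_deform.1 h1
  have h3 : (⟨_, hmem⟩ : L) = (t i * c ^ e i : ℂ) • chartGen hL i :=
    Subtype.ext htw
  have h4 : φ' ((t i * c ^ e i : ℂ) • chartGen hL i) =
      (t i * c ^ e i : ℂ) • φ' (chartGen hL i) := LinearMap.map_smul_of_tower _ _ _
  rw [h3, h4] at h2
  have h5 := congrArg (quotCoeff hL j s hs) h2
  rw [quotCoeff_mkQ, map_smul, smul_eq_mul] at h5
  rw [chartCoord_eq hL j s hs (pair_mem_deform.1 hb).2]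
  change _ * quotCoeff hL j s hs (φ' (chartGen hL i)) = _
  rw [← h5, twist, Polynomial.coeff_C_mul, coeff_scale, mul_assoc]

end Chart

/-! ### The overlap of the two charts -/

section Overlap

variable {n : ℕ} {δ : Finset (Fin n)} {e : Fin n → ℕ} {L : Submodule ℂ[X] (Fin n → ℂ[X])}

/-- On the overlap of the two charts the monomials are invertible. -/
lemma mem_push_res0_monomialChart (hL : L = monomialChart δ e) {g : Fin n → ℂ[T;T⁻¹]} :
    g ∈ push res0 1 L ↔ ∀ j ∉ δ, g j = 0 := by
  constructor
  · intro hg j hj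
    obtain ⟨m, f, hf, h⟩ := (mem_push_res0 L g).1 hg
    rw [hL, mem_monomialChart] at hf
    have h1 := h j
    rw [hf.2 j hj, map_zero] at h1
    linear_combination T (-m) * -h1 - g j * T_mul_T_neg (R := ℂ) m
  · intro h
    have h1 : g = ∑ j ∈ δ, (g j * T (-(e j : ℤ))) •
        (fun k => (1 : Fin n → ℂ[T;T⁻¹]) k * res0 ((Pi.single j (X ^ e j) : Fin n → ℂ[X]) k)) := by
      ext1 k
      rw [Finset.sum_apply]
      have h2 (j : Fin n) (hj : j ≠ k) : ((g j * T (-(e j : ℤ))) • (fun k =>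
          (1 : Fin n → ℂ[T;T⁻¹]) k * res0 ((Pi.single j (X ^ e j) : Fin n → ℂ[X]) k))) k = 0 := by
        simp [Pi.single_eq_of_ne hj.symm]
      by_cases hk : k ∈ δ
      · rw [Finset.sum_eq_single k (fun j _ hj => h2 j hj) (fun h => absurd hk h)]
        simp only [Pi.smul_apply, Pi.one_apply, Pi.single_eq_same, map_pow, res0_X, T_pow, mul_one,
          smul_eq_mul, one_mul]
        linear_combination -g k * T_mul_T_neg (R := ℂ) (e k)
      · rw [Finset.sum_eq_zero fun j hj => h2 j fun h => hk (h ▸ hj), h k hk]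
    rw [h1]
    refine Submodule.sum_mem _ fun j hj => Submodule.smul_mem _ _ (mem_push_of_mem res0 1 ?_)
    rw [hL]
    exact single_mem_monomialChart hj

/-- The sections of `𝒪(N)` have degree at most `N` on either chart, hence vanish as soon as their
coefficients up to `N` do. -/
lemma eq_zero_of_res0_eq {N : ℕ} {p q : ℂ[X]} (h : res0 p = T N * res1 q)
    (hp : ∀ s ≤ N, p.coeff s = 0) : p = 0 ∧ q = 0 := by
  have hp0 : p = 0 := by
    -- Both sides are `T ^ N * q(T⁻¹)`, multiplied by `T ^ deg q` to clear denominators.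
    have h1 : p * X ^ q.natDegree = q.reverse * X ^ N := by
      apply Polynomial.toLaurent_injective
      rw [map_mul, map_mul, LaurentPolynomial.toLaurent_reverse]
      have h2 : toLaurent p = T N * invert (toLaurent q) := h
      rw [h2, Polynomial.toLaurent_X_pow, Polynomial.toLaurent_X_pow]
      ring
    ext s
    by_cases hs : s ≤ N
    · simp [hp s hs]
    · have h2 := congrArg (fun r => coeff r (s + q.natDegree)) h1
      simp only [coeff_mul_X_pow] at h2
      rw [h2, coeff_mul_X_pow', if_pos (by omega), coeff_zero]
      exact coeff_eq_zero_of_natDegree_lt (by have := reverse_natDegree_le q; omega)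
  refine ⟨hp0, res1_injective ?_⟩
  rw [hp0, map_zero] at h
  rw [map_zero]
  linear_combination T (-(N : ℤ)) * -h - res1 q * T_mul_T_neg (R := ℂ) N

end Overlap

/-! ### Global homomorphisms at a torus-fixed point -/

section GlobalHom

variable {n : ℕ} {δ : Finset (Fin n)} {a b : Fin n → ℕ} {K : Subsheaf ℂ n}

variable (δ a b) in
/-- The index set of a basis of `Hom(K, 𝒪 ^ n / K)` for the kernel `K` of a torus-fixed point.
The first part stands for the monomials of degree `a_i + b_i` in
`Hom(𝒪(- a_i - b_i), 𝒪) = H⁰(𝒪(a_i + b_i))`, and the other two for the monomials in the stalks at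
`x = 0` and at `y = 0` of the torsion sheaf `𝒪 / (x ^ a_j y ^ b_j)`. -/
abbrev HomIndex : Type :=
  (Σ p : δ × (δᶜ : Finset (Fin n)), Fin (a p.1 + b p.1 + 1)) ⊕
    (Σ p : δ × δ, Fin (a p.2)) ⊕ (Σ p : δ × δ, Fin (b p.2))

/-- The weight of the homomorphism that belongs to an index. -/
def homWeight : HomIndex δ a b → Weight n
  | .inl ⟨(i, j), s⟩ => weight i j (-(a i : ℤ) + (s : ℕ))
  | .inr (.inl ⟨(i, j), s⟩) => weight i j (-(a i : ℤ) + (s : ℕ))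
  | .inr (.inr ⟨(i, j), s⟩) => weight i j ((b i : ℤ) - (s : ℕ))

/-- The coordinates of a global homomorphism `K → 𝒪 ^ n / K`. Those with values in a torsion-free
summand are read off on the chart `y ≠ 0`. -/
def homCoord (hm : IsMonomial K δ a b) : globalHom K →ₗ[ℂ] (HomIndex δ a b → ℂ) :=
  LinearMap.pi fun
    | .inl ⟨(i, j), s⟩ =>
      chartCoord hm.1 i j s (fun h => absurd h (Finset.mem_compl.1 j.2)) ∘ₗ
        LinearMap.fst ℂ _ _ ∘ₗ (globalHom K).subtype
    | .inr (.inl ⟨(i, j), s⟩) =>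
      chartCoord hm.1 i j s (fun _ => s.2) ∘ₗ LinearMap.fst ℂ _ _ ∘ₗ (globalHom K).subtype
    | .inr (.inr ⟨(i, j), s⟩) =>
      chartCoord hm.2 i j s (fun _ => s.2) ∘ₗ LinearMap.snd ℂ _ _ ∘ₗ (globalHom K).subtype

/-- Homomorphisms on the two charts, given on generators, glue if they do so in the torsion-free
summands. The torsion summands vanish on the overlap. -/
lemma constr_mem_globalHom (hm : IsMonomial K δ a b) (B B' : δ → Fin n → ℂ[X])
    (h : ∀ i : δ, ∀ j ∉ δ, res0 (B i j) = T (a i + b i) * res1 (B' i j)) :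
    ((chartBasis hm.1).constr ℂ fun i => K.K0.mkQ (B i),
      (chartBasis hm.2).constr ℂ fun i => K.K1.mkQ (B' i)) ∈ globalHom K := by
  intro m f f' hf
  refine ⟨∑ i, (chartBasis hm.1).repr f i • B i, ∑ i, (chartBasis hm.2).repr f' i • B' i, ?_, ?_,
    (mem_push_res0_monomialChart hm.1).2 fun j hj => ?_⟩
  · simp [Module.Basis.constr_apply_fintype]
  · simp [Module.Basis.constr_apply_fintype]
  · simp only [Finset.sum_apply, Pi.smul_apply, smul_eq_mul, map_sum, map_mul, Finset.mul_sum]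
    rw [← Finset.sum_sub_distrib]
    refine Finset.sum_eq_zero fun i _ => ?_
    have h1 := hf i
    rw [apply_eq_repr_mul hm.1, apply_eq_repr_mul hm.2] at h1
    simp only [map_mul, map_pow, res0_X, res1_X, T_pow, mul_one, mul_neg] at h1
    rw [h i j hj, T_add]
    linear_combination T (b i) * res1 (B' i j) * h1 +
      T m * res1 ((chartBasis hm.2).repr f' i) * res1 (B' i j) * T_mul_T_neg (R := ℂ) (b i)

lemma homCoord_injective (hm : IsMonomial K δ a b) : Function.Injective (homCoord hm) := by
  rw [injective_iff_map_eq_zero]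
  intro φ hφ
  have hgen (i : δ) : φ.1.1 (chartGen hm.1 i) = 0 ∧ φ.1.2 (chartGen hm.2 i) = 0 := by
    -- On the overlap the two generators differ by the factor `T ^ (a_i + b_i)`.
    obtain ⟨B, B', hB, hB', hg⟩ := φ.2 (a i + b i) (chartGen hm.1 i) (chartGen hm.2 i) (by
      intro j
      by_cases hj : j = i
      · subst hj
        simp only [chartGen, Pi.single_eq_same, map_pow, res0_X, res1_X, T_pow, ← T_add]
        congr 1
        ring
      · simp [chartGen, hj])
    rw [Subsheaf.K01, mem_push_res0_monomialChart hm.1] at hg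
    have hzero (j : Fin n) (hj : j ∉ δ) : B j = 0 ∧ B' j = 0 := by
      refine eq_zero_of_res0_eq (N := a i + b i) ?_ fun s hs => ?_
      · push_cast
        exact sub_eq_zero.1 (hg j hj)
      · have h1 := congrFun hφ
          (.inl ⟨(i, ⟨j, Finset.mem_compl.2 hj⟩), ⟨s, Nat.lt_succ_of_le hs⟩⟩)
        exact (chartCoord_eq hm.1 j s (fun h => absurd h hj) hB).symm.trans h1
    rw [← hB, ← hB', Submodule.mkQ_apply, Submodule.mkQ_apply, Submodule.Quotient.mk_eq_zero,
      Submodule.Quotient.mk_eq_zero, hm.1, hm.2, mem_monomialChart, mem_monomialChart]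
    refine ⟨⟨fun j hj => X_pow_dvd_iff.2 fun s hs => ?_, fun j hj => (hzero j hj).1⟩,
      fun j hj => X_pow_dvd_iff.2 fun s hs => ?_, fun j hj => (hzero j hj).2⟩
    · have h1 := congrFun hφ (.inr (.inl ⟨(i, ⟨j, hj⟩), ⟨s, hs⟩⟩))
      exact (chartCoord_eq hm.1 j s (fun _ => hs) hB).symm.trans h1
    · have h1 := congrFun hφ (.inr (.inr ⟨(i, ⟨j, hj⟩), ⟨s, hs⟩⟩))
      exact (chartCoord_eq hm.2 j s (fun _ => hs) hB').symm.trans h1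
  refine Subtype.ext (Prod.ext ?_ ?_)
  · refine (chartBasis hm.1).ext fun i => ?_
    rw [chartBasis_apply, (hgen i).1]
    rfl
  · refine (chartBasis hm.2).ext fun i => ?_
    rw [chartBasis_apply, (hgen i).2]
    rfl

lemma coeff_sum_C_mul_X_pow {N : ℕ} (c : Fin N → ℂ) (s : Fin N) :
    (∑ k, Polynomial.C (c k) * X ^ (k : ℕ)).coeff s = c s := by
  simp only [Polynomial.finsetSum_coeff, Polynomial.coeff_C_mul, coeff_X_pow]
  rw [Finset.sum_eq_single s]
  · simp
  · intro k _ hk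
    rw [if_neg fun h => hk (Fin.ext h.symm), mul_zero]
  · simp

lemma homCoord_surjective (hm : IsMonomial K δ a b) : Function.Surjective (homCoord hm) := by
  intro c
  let B (i : δ) (j : Fin n) : ℂ[X] :=
    if h : j ∈ δ then ∑ s, Polynomial.C (c (.inr (.inl ⟨(i, ⟨j, h⟩), s⟩))) * X ^ (s : ℕ)
    else ∑ s, Polynomial.C (c (.inl ⟨(i, ⟨j, Finset.mem_compl.2 h⟩), s⟩)) * X ^ (s : ℕ)
  -- In the coordinate `y / x` a section `∑ c_s X ^ s` of `𝒪(N)` becomes `∑ c_s X ^ (N - s)`.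
  let B' (i : δ) (j : Fin n) : ℂ[X] :=
    if h : j ∈ δ then ∑ s, Polynomial.C (c (.inr (.inr ⟨(i, ⟨j, h⟩), s⟩))) * X ^ (s : ℕ)
    else ∑ s, Polynomial.C (c (.inl ⟨(i, ⟨j, Finset.mem_compl.2 h⟩), s⟩)) *
      X ^ (a i + b i - (s : ℕ))
  refine ⟨⟨_, constr_mem_globalHom hm B B' fun i j hj => ?_⟩, funext ?_⟩
  · simp only [B, B', hj, dite_false, map_sum, map_mul, map_pow, res0_C, res1_C, res0_X, res1_X,
      T_pow, Finset.mul_sum]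
    refine Finset.sum_congr rfl fun s _ => ?_
    have hs : (s : ℕ) ≤ a i + b i := Nat.le_of_lt_succ s.2
    rw [mul_left_comm, ← T_add]
    congr 2
    push_cast [hs]
    ring
  · rintro (⟨⟨i, j⟩, s⟩ | ⟨⟨i, j⟩, s⟩ | ⟨⟨i, j⟩, s⟩)
    · have hj : (j : Fin n) ∉ δ := Finset.mem_compl.1 j.2
      refine (chartCoord_eq hm.1 j s (fun h => absurd h hj) (b := B i) ?_).trans ?_
      · exact (constr_chartBasis_chartGen hm.1 (fun i => K.K0.mkQ (B i)) i).symm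
      · simp only [B, hj, dite_false]
        exact coeff_sum_C_mul_X_pow _ s
    · refine (chartCoord_eq hm.1 j s (fun _ => s.2) (b := B i) ?_).trans ?_
      · exact (constr_chartBasis_chartGen hm.1 (fun i => K.K0.mkQ (B i)) i).symm
      · simp only [B, j.2, dite_true]
        exact coeff_sum_C_mul_X_pow _ s
    · refine (chartCoord_eq hm.2 j s (fun _ => s.2) (b := B' i) ?_).trans ?_
      · exact (constr_chartBasis_chartGen hm.2 (fun i => K.K1.mkQ (B' i)) i).symm
      · simp only [B', j.2, dite_true]
        exact coeff_sum_C_mul_X_pow _ s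

end GlobalHom

/-! ### The tangent representation at a torus-fixed point -/

section Tangent

variable {n r d : ℕ} {x : QuotPoint ℂ n r d} {δ : Finset (Fin n)} {a b : Fin n → ℕ}

/-- Coordinates on the tangent space at a torus-fixed point. -/
def tangentCoord (hm : IsMonomial x.1 δ a b) : TangentSpace x ≃ₗ[ℂ] (HomIndex δ a b → ℂ) :=
  ((tangentEquiv x).linearEquiv ℂ).trans
    (LinearEquiv.ofBijective (homCoord hm) ⟨homCoord_injective hm, homCoord_surjective hm⟩)

lemma tangentCoord_ofHom (hm : IsMonomial x.1 δ a b) (φ : globalHom x.1) :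
    tangentCoord hm (ofHom x φ) = homCoord hm φ :=
  congrArg (homCoord hm) ((tangentEquiv x).apply_symm_apply φ)

lemma tangentCoord_tangentRep (hx : ∀ g : Torus n, x.1.act g = x.1) (hm : IsMonomial x.1 δ a b)
    (g : Torus n) (u : TangentSpace x) (k : HomIndex δ a b) :
    tangentCoord hm (tangentRep x hx g u) k = (homWeight k).eval g * tangentCoord hm u k := by
  obtain ⟨φ, rfl⟩ := ofHom_bijective.2 u
  obtain ⟨φ', hφ⟩ := ofHom_bijective.2 (tangentRep x hx g (ofHom x φ))
  rw [← hφ, tangentCoord_ofHom, tangentCoord_ofHom]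
  have h0 : twistD g.2 g.1 (deform x.1.K0 φ.1.1) = deform x.1.K0 φ'.1.1 :=
    congrArg (fun u => u.1.1.K0) hφ.symm
  -- The coordinate `y / x` of the second chart is scaled by `q⁻¹`.
  have h1 : twistD g.2⁻¹ g.1 (deform x.1.K1 φ.1.2) = deform x.1.K1 φ'.1.2 :=
    congrArg (fun u => u.1.1.K1) hφ.symm
  have hq : (g.2 : ℂ) ≠ 0 := g.2.ne_zero
  rcases k with ⟨⟨i, j⟩, s⟩ | ⟨⟨i, j⟩, s⟩ | ⟨⟨i, j⟩, s⟩
  · have ht : (g.1 i : ℂ) ≠ 0 := (g.1 i).ne_zero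
    have h := chartCoord_twistD hm.1 h0 i j s (fun h => absurd h (Finset.mem_compl.1 j.2))
    simp only [homWeight, Weight.eval_weight]
    rw [zpow_add₀ hq, zpow_neg, zpow_natCast, zpow_natCast]
    refine mul_left_cancel₀ (mul_ne_zero ht (pow_ne_zero (a i) hq)) (h.trans ?_)
    simp only [homCoord, LinearMap.pi_apply, LinearMap.comp_apply, LinearMap.fst_apply,
      Submodule.subtype_apply]
    field_simp
  · have ht : (g.1 i : ℂ) ≠ 0 := (g.1 i).ne_zero
    have h := chartCoord_twistD hm.1 h0 i j s (fun _ => s.2)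
    simp only [homWeight, Weight.eval_weight]
    rw [zpow_add₀ hq, zpow_neg, zpow_natCast, zpow_natCast]
    refine mul_left_cancel₀ (mul_ne_zero ht (pow_ne_zero (a i) hq)) (h.trans ?_)
    simp only [homCoord, LinearMap.pi_apply, LinearMap.comp_apply, LinearMap.fst_apply,
      Submodule.subtype_apply]
    field_simp
  · have ht : (g.1 i : ℂ) ≠ 0 := (g.1 i).ne_zero
    have h := chartCoord_twistD hm.2 h1 i j s (fun _ => s.2)
    simp only [homWeight, Weight.eval_weight]
    rw [zpow_sub₀ hq, zpow_natCast, zpow_natCast]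
    rw [Units.val_inv_eq_inv_val, inv_pow, inv_pow] at h
    refine mul_left_cancel₀ (mul_ne_zero ht (inv_ne_zero (pow_ne_zero (b i) hq))) (h.trans ?_)
    simp only [homCoord, LinearMap.pi_apply, LinearMap.comp_apply, LinearMap.snd_apply,
      Submodule.subtype_apply]
    field_simp

/-- The basis of the tangent space at a torus-fixed point that is dual to the coordinates. -/
def tangentBasis (hm : IsMonomial x.1 δ a b) :
    Module.Basis (HomIndex δ a b) ℂ (TangentSpace x) :=
  Module.Basis.ofEquivFun (tangentCoord hm)

lemma tangentRep_apply_tangentBasis (hx : ∀ g : Torus n, x.1.act g = x.1)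
    (hm : IsMonomial x.1 δ a b) (g : Torus n) (k : HomIndex δ a b) :
    tangentRep x hx g (tangentBasis hm k) = (homWeight k).eval g • tangentBasis hm k := by
  apply (tangentCoord hm).injective
  ext1 l
  rw [tangentCoord_tangentRep, map_smul, Pi.smul_apply, smul_eq_mul]
  by_cases hl : l = k
  · rw [hl]
  · simp [tangentBasis, hl]

end Tangent

/-! ### The list of weights -/

section Multisets

variable {n : ℕ} {δ : Finset (Fin n)} {a b : Fin n → ℕ}

lemma val_map_eq_sum_singleton {α β : Type*} (s : Finset α) (f : α → β) :
    s.val.map f = ∑ x ∈ s, {f x} := by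
  rw [Finset.sum_eq_multiset_sum, ← Multiset.sum_map_singleton (s.val.map f), Multiset.map_map]
  rfl

lemma sum_range_weight_add (a a' : ℕ) (i j : Fin n) :
    ∑ s ∈ Finset.range a', ({weight i j (-(a : ℤ) + (s : ℕ))} : Multiset (Weight n)) =
      ∑ s ∈ Finset.Icc (-(a : ℤ)) (-(a : ℤ) + a' - 1), {weight i j s} := by
  refine Finset.sum_nbij' (fun s : ℕ => -(a : ℤ) + s) (fun t => (t + a).toNat) ?_ ?_ ?_ ?_ ?_
  · intro s hs
    simp only [Finset.mem_range, Finset.mem_Icc] at hs ⊢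
    omega
  · intro t ht
    simp only [Finset.mem_range, Finset.mem_Icc] at ht ⊢
    omega
  · intro s _
    simp
  · intro t ht
    simp only [Finset.mem_Icc] at ht
    omega
  · intro s _
    rfl

lemma sum_range_weight_sub (b b' : ℕ) (i j : Fin n) :
    ∑ s ∈ Finset.range b', ({weight i j ((b : ℤ) - (s : ℕ))} : Multiset (Weight n)) =
      ∑ s ∈ Finset.Icc ((b : ℤ) - b' + 1) b, {weight i j s} := by
  refine Finset.sum_nbij' (fun s : ℕ => (b : ℤ) - s) (fun t => (b - t).toNat) ?_ ?_ ?_ ?_ ?_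
  · intro s hs
    simp only [Finset.mem_range, Finset.mem_Icc] at hs ⊢
    omega
  · intro t ht
    simp only [Finset.mem_range, Finset.mem_Icc] at ht ⊢
    omega
  · intro s _
    simp
  · intro t ht
    simp only [Finset.mem_Icc] at ht
    omega
  · intro s _
    rfl

/-- The exponents `-a, …, -1` from one chart and `1, …, b` from the other are those between `-a`
and `b` other than `0`. -/
lemma sum_range_weight_self (a b : ℕ) (i : Fin n) :
    (∑ s ∈ Finset.range a, ({weight i i (-(a : ℤ) + (s : ℕ))} : Multiset (Weight n))) +
      ∑ s ∈ Finset.range b, {weight i i ((b : ℤ) - (s : ℕ))} =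
      ∑ s ∈ (Finset.range (a + b + 1)).erase a, {weight i i (-(a : ℤ) + (s : ℕ))} := by
  rw [← Finset.sum_filter_add_sum_filter_not ((Finset.range (a + b + 1)).erase a) (· < a)]
  congr 1
  · refine Finset.sum_congr (Finset.ext fun s => ?_) fun _ _ => rfl
    simp only [Finset.mem_range, Finset.mem_filter, Finset.mem_erase]
    omega
  · refine Finset.sum_nbij' (fun s => a + b - s) (fun t => a + b - t) ?_ ?_ ?_ ?_ ?_
    · intro s hs
      simp only [Finset.mem_range, Finset.mem_filter, Finset.mem_erase] at hs ⊢
      omega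
    · intro t ht
      simp only [Finset.mem_range, Finset.mem_filter, Finset.mem_erase] at ht ⊢
      omega
    · intro s hs
      simp only [Finset.mem_range] at hs
      omega
    · intro t ht
      simp only [Finset.mem_range, Finset.mem_filter, Finset.mem_erase] at ht
      omega
    · intro s hs
      simp only [Finset.mem_range] at hs
      congr 2
      omega

lemma sum_sum_eq_sum_diag_add_sum_offDiag {α M : Type*} [DecidableEq α] [AddCommMonoid M]
    (s : Finset α) (f : α → α → M) :
    ∑ i ∈ s, ∑ j ∈ s, f i j = ∑ i ∈ s, f i i + ∑ p ∈ s.offDiag, f p.1 p.2 := by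
  rw [← Finset.sum_product', ← Finset.diag_union_offDiag,
    Finset.sum_union (Finset.disjoint_diag_offDiag s), Finset.sum_diag]

lemma sum_coe_sort_coe_sort {α M : Type*} [AddCommMonoid M] (s t : Finset α) (f : α → α → M) :
    ∑ i : s, ∑ j : t, f i j = ∑ i ∈ s, ∑ j ∈ t, f i j := by
  rw [← Finset.sum_coe_sort s]
  exact Finset.sum_congr rfl fun i _ => Finset.sum_coe_sort t (f i)

/-- The pairs `i = j` among the stalks account for the powers of `q` in the list of weights, and
the pairs `i ≠ j` for its last two parts. -/
lemma map_homWeight :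
    (Finset.univ : Finset (HomIndex δ a b)).val.map homWeight = tangentWeights δ a b := by
  rw [val_map_eq_sum_singleton, Fintype.sum_sum_type, Fintype.sum_sum_type, Fintype.sum_sigma,
    Fintype.sum_sigma, Fintype.sum_sigma, Fintype.sum_prod_type, Fintype.sum_prod_type,
    Fintype.sum_prod_type]
  simp only [homWeight, tangentWeights, val_map_eq_sum_singleton]
  simp only [← sum_range_weight_add, ← sum_range_weight_sub, ← sum_range_weight_self]
  simp only [Finset.sum_range]
  rw [sum_coe_sort_coe_sort δ δᶜ (fun i j => ∑ s : Fin (a i + b i + 1),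
      ({weight i j (-(a i : ℤ) + (s : ℕ))} : Multiset (Weight n))),
    sum_coe_sort_coe_sort δ δ (fun i j => ∑ s : Fin (a j),
      ({weight i j (-(a i : ℤ) + (s : ℕ))} : Multiset (Weight n))),
    sum_coe_sort_coe_sort δ δ (fun i j => ∑ s : Fin (b j),
      ({weight i j ((b i : ℤ) - (s : ℕ))} : Multiset (Weight n)))]
  rw [sum_sum_eq_sum_diag_add_sum_offDiag, sum_sum_eq_sum_diag_add_sum_offDiag,
    Finset.sum_add_distrib]
  abel

lemma prod_map_tangentWeights {M : Type*} [CommMonoid M] (f : Weight n → M) :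
    ((tangentWeights δ a b).map f).prod =
      (∏ i ∈ δ, ∏ j ∈ δᶜ, ∏ s ∈ Finset.range (a i + b i + 1), f (weight i j (-(a i : ℤ) + s))) *
      (∏ i ∈ δ, ∏ s ∈ (Finset.range (a i + b i + 1)).erase (a i),
        f (weight i i (-(a i : ℤ) + s))) *
      (∏ p ∈ δ.offDiag, ∏ s ∈ Finset.Icc (-(a p.1 : ℤ)) (-(a p.1 : ℤ) + a p.2 - 1),
        f (weight p.1 p.2 s)) *
      (∏ p ∈ δ.offDiag, ∏ s ∈ Finset.Icc ((b p.1 : ℤ) - b p.2 + 1) (b p.1 : ℤ),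
        f (weight p.1 p.2 s)) := by
  simp only [tangentWeights, ← Multiset.coe_mapAddMonoidHom, map_add, map_sum, Multiset.prod_add,
    Multiset.prod_sum]
  simp only [Multiset.coe_mapAddMonoidHom, Multiset.map_map]
  rfl

end Multisets

lemma lambdaY_dual_eq {n r d : ℕ} {x : QuotPoint ℂ n r d} {δ : Finset (Fin n)} {a b : Fin n → ℕ}
    (hx : ∀ g : Torus n, x.1.act g = x.1) (hm : IsMonomial x.1 δ a b) :
    lambdaY (tangentRep x hx).dual = ((tangentWeights δ a b).map fun w => factor (-w)).prod := by
  classical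
  rw [lambdaY_eq_prod (tangentBasis hm).dualBasis (fun k => -homWeight k)
    (dual_apply_dualBasis _ _ (tangentRep_apply_tangentBasis hx hm)), ← map_homWeight,
    Multiset.map_map]
  rfl

end QuotP1

end

open QuotP1 in
theorem mainTheorem6 (n r d : ℕ) (x : QuotPoint ℂ n r d) (hx : ∀ g : Torus n, x.1.act g = x.1)
    (δ : Finset (Fin n)) (a b : Fin n → ℕ) (hm : IsMonomial x.1 δ a b) :
    (∃ (ι : Type) (_ : Fintype ι) (v : Module.Basis ι ℂ (TangentSpace x)) (w : ι → Weight n),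
      (∀ g k, tangentRep x hx g (v k) = (w k).eval g • v k) ∧
      Finset.univ.val.map w = tangentWeights δ a b) ∧
    ((∀ i ∈ δ, b i = 0) →
      lambdaY (tangentRep x hx).dual =
        (∏ i ∈ δ, ∏ j ∈ δᶜ, ∏ m ∈ Finset.Icc 0 (a i), factor (weight j i (m : ℤ))) *
        (∏ i ∈ δ, ∏ m ∈ Finset.Icc 1 (a i), factor (weight i i (m : ℤ))) *
        (∏ p ∈ δ.offDiag, ∏ m ∈ Finset.Icc (-(a p.1 : ℤ)) (-(a p.1 : ℤ) + a p.2 - 1),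
          factor (weight p.2 p.1 (-m)))) := by
  refine ⟨⟨HomIndex δ a b, inferInstance, tangentBasis hm, homWeight,
    tangentRep_apply_tangentBasis hx hm, map_homWeight⟩, fun hb => ?_⟩
  rw [lambdaY_dual_eq hx hm, prod_map_tangentWeights]
  simp only [neg_weight]
  -- At a point supported at `x = 0` the torsion of the quotient vanishes on the chart `x ≠ 0`.
  have hlast : ∏ p ∈ δ.offDiag, ∏ s ∈ Finset.Icc ((b p.1 : ℤ) - b p.2 + 1) (b p.1 : ℤ),
      factor (weight p.2 p.1 (-s)) = 1 := by
    refine Finset.prod_eq_one fun p hp => ?_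
    obtain ⟨h1, h2, -⟩ := Finset.mem_offDiag.1 hp
    simp [hb _ h1, hb _ h2]
  rw [hlast, mul_one]
  -- In the first two factors the substitution of exponents is `m = a_i - s`.
  refine congrArg (· * _) (congrArg₂ (· * ·) ?_ ?_)
  · refine Finset.prod_congr rfl fun i hi => Finset.prod_congr rfl fun j _ => ?_
    rw [hb i hi]
    refine Finset.prod_nbij' (fun s => a i - s) (fun m => a i - m) ?_ ?_ ?_ ?_ ?_
    all_goals
      intro s hs
      simp only [Finset.mem_range, Finset.mem_Icc] at hs ⊢
    all_goals first | omega | (congr 2; omega)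
  · refine Finset.prod_congr rfl fun i hi => ?_
    rw [hb i hi]
    refine Finset.prod_nbij' (fun s => a i - s) (fun m => a i - m) ?_ ?_ ?_ ?_ ?_
    all_goals
      intro s hs
      simp only [Finset.mem_range, Finset.mem_erase, Finset.mem_Icc] at hs ⊢
    all_goals first | omega | (congr 2; omega)
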